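/- Let $\mathbf{k}$ be a nonzero commutative ring with unit. For a path connected pointed space $(X,x)$ let $C^0_*(X)$ be the connected dg coalgebra of normalized singular chains (with $\mathbf{k}$-coefficients) generated by the singular simplices all of whose vertices are at $x$, with the Alexander--Whitney coproduct, and let $\mathbf{\Omega}$ denote the cobar construction. A pointed map $f$ is said to induce an $\mathbf{\Omega}$-quasi-isomorphism if $\mathbf{\Omega}C^0_*(f)$ is a quasi-isomorphism of dg algebras. The algebra $H_0(\mathbf{\Omega}C^0_*(X))$ is generated by the classes $[\sigma]$ of loops $\sigma$ at $x$, and is a bialgebra with coproduct $\nabla[\sigma]=[\sigma]\otimes[\sigma]+[\sigma]\otimes 1+1\otimes[\sigma]$ and counit $\epsilon[\sigma]=0$. The product of $\pi_1$ is concatenation of loops in path order, and $Grp(H)=\{g\in H:\epsilon(g)=1,\ \nabla g=g\otimes g\}$. Let $f:(X,x)\to(Y,y)$ be a continuous map of path connected pointed spaces which induces an $\mathbf{\Omega}$-quasi-isomorphism $C^0_*(X)\to C^0_*(Y)$. Then: 1. $\pi_1(f):\pi_1(X)\to\pi_1(Y)$ is an isomorphism of groups. 2. The bialgebras $H_0(\mathbf{\Omega}C^0_*(X))$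 and $H_0(\mathbf{\Omega}C^0_*(Y))$ admit antipodes, i.e. they are Hopf algebras, and $H_0(\mathbf{\Omega}C^0_*(f))$ is an isomorphism of Hopf algebras. There are bialgebra isomorphisms $\psi_X:H_0(\mathbf{\Omega}C^0_*(X))\to\mathbf{k}[\pi_1(X)]$ and $\psi_Y:H_0(\mathbf{\Omega}C^0_*(Y))\to\mathbf{k}[\pi_1(Y)]$ which send the class $[\sigma]$ of a loop $\sigma$ to $g_\sigma-e$, where $g_\sigma$ is the homotopy class of $\sigma$ and $e$ is the identity element, and $\psi_Y\circ H_0(\mathbf{\Omega}C^0_*(f))=\mathbf{k}[\pi_1(f)]\circ\psi_X$. 3. The map $Grp(H_0(\mathbf{\Omega}C^0_*(f)))$ is bijective and recovers $\pi_1(f)$: the rule $g\mapsto\psi^{-1}(g)$ defines injective multiplicative maps $\kappa_X:\pi_1(X)\to Grp(H_0(\mathbf{\Omega}C^0_*(X)))$ and $\kappa_Y:\pi_1(Y)\to Grp(H_0(\mathbf{\Omega}C^0_*(Y)))$ with $Grp(H_0(\mathbf{\Omega}C^0_*(f)))\circ\kappa_X=\kappa_Y\circ\pi_1(f)$, and if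 $\mathbf{k}$ has no idempotents other than $0$ and $1$, then $\kappa_X$ and $\kappa_Y$ are isomorphisms. -/

import Mathlib

open CategoryTheory Opposite TensorProduct DirectSum

universe u v w w'

/-! ### Differential graded algebras and their homology -/

/-- A unital associative differential graded algebra over `k`, concentrated in degrees `≥ 0`, with
differential of degree `-1`. -/
structure DGAlg (k : Type v) [CommRing k] where
  carrier : Type w
  [ring : Ring carrier]
  [algebra : Algebra k carrier]
  deg : ℕ → Submodule k carrier
  [graded : GradedAlgebra deg]
  D : carrier →ₗ[k] carrier
  D_deg_zero : ∀ a ∈ deg 0, D a = 0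
  D_deg_succ : ∀ n, ∀ a ∈ deg (n + 1), D a ∈ deg n
  D_D : ∀ a, D (D a) = 0
  leibniz : ∀ n, ∀ a ∈ deg n, ∀ b, D (a * b) = D a * b + (-1 : k) ^ n • (a * D b)

attribute [instance] DGAlg.ring DGAlg.algebra DGAlg.graded

/-- A morphism of differential graded algebras. -/
structure DGAlg.Hom {k : Type v} [CommRing k] (A : DGAlg.{v, w} k) (B : DGAlg.{v, w'} k) where
  toAlgHom : A.carrier →ₐ[k] B.carrier
  map_deg : ∀ n, ∀ a ∈ A.deg n, toAlgHom a ∈ B.deg n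
  map_D : ∀ a, toAlgHom (A.D a) = B.D (toAlgHom a)

namespace DGAlg

section
variable {k : Type v} [CommRing k] (A : DGAlg.{v, w} k)

/-- The `n`-cycles. -/
def cycles (n : ℕ) : Submodule k A.carrier := A.deg n ⊓ LinearMap.ker A.D

lemma cycles_le_deg (n : ℕ) : A.cycles n ≤ A.deg n := inf_le_left

/-- The `n`-boundaries. -/
def boundaries (n : ℕ) : Submodule k A.carrier := (A.deg (n + 1)).map A.D

lemma boundaries_le_cycles (n : ℕ) : A.boundaries n ≤ A.cycles n := by
  rintro _ ⟨a, ha, rfl⟩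
  exact ⟨A.D_deg_succ n a ha, A.D_D a⟩

/-- The `n`-th homology `k`-module. -/
abbrev Homology (n : ℕ) : Type w :=
  (A.cycles n) ⧸ (A.boundaries n).submoduleOf (A.cycles n)

/-- The boundaries in degree `0`, as a two-sided ideal of the algebra of degree `0` elements
(all of which are cycles). -/
def boundaryIdeal : Ideal (A.deg 0) where
  carrier := {a | (a : A.carrier) ∈ A.boundaries 0}
  add_mem' {a b} ha hb := by simpa using! add_mem ha hb
  zero_mem' := by simp
  smul_mem' := by
    rintro ⟨a, ha⟩ ⟨b, hb⟩ ⟨c, hc, hcb⟩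
    refine ⟨a * c, by simpa using! SetLike.mul_mem_graded ha hc, ?_⟩
    have := A.leibniz 0 a ha c
    rw [A.D_deg_zero a ha] at this
    simpa [hcb] using! this

instance : A.boundaryIdeal.IsTwoSided where
  mul_mem_of_left := by
    rintro ⟨b, hb⟩ ⟨a, ha⟩ ⟨c, hc, hcb⟩
    refine ⟨c * a, by simpa using! SetLike.mul_mem_graded hc ha, ?_⟩
    have := A.leibniz 1 c hc a
    rw [A.D_deg_zero a ha] at this
    simpa [hcb] using! this

/-- The homology in degree `0`, as a `k`-algebra. -/
abbrev H0 : Type w := (A.deg 0) ⧸ A.boundaryIdeal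

/-- The class in `H0` of an element of degree zero. -/
def mk0 (a : A.carrier) (h : a ∈ A.deg 0) : A.H0 := Ideal.Quotient.mk A.boundaryIdeal ⟨a, h⟩

lemma mk0_add {a b : A.carrier} (h : a ∈ A.deg 0) (h' : b ∈ A.deg 0) (h'' : a + b ∈ A.deg 0) :
    A.mk0 (a + b) h'' = A.mk0 a h + A.mk0 b h' := rfl

lemma mk0_sub {a b : A.carrier} (h : a ∈ A.deg 0) (h' : b ∈ A.deg 0) (h'' : a - b ∈ A.deg 0) :
    A.mk0 (a - b) h'' = A.mk0 a h - A.mk0 b h' := rfl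

lemma mk0_mul {a b : A.carrier} (h : a ∈ A.deg 0) (h' : b ∈ A.deg 0) (h'' : a * b ∈ A.deg 0) :
    A.mk0 (a * b) h'' = A.mk0 a h * A.mk0 b h' := rfl

lemma mk0_smul {a : A.carrier} (r : k) (h : a ∈ A.deg 0) (h' : r • a ∈ A.deg 0) :
    A.mk0 (r • a) h' = r • A.mk0 a h := rfl

lemma mk0_eq_zero {a c : A.carrier} (h : a ∈ A.deg 0) (hc : c ∈ A.deg 1) (e : A.D c = a) :
    A.mk0 a h = 0 :=
  (Ideal.Quotient.eq_zero_iff_mem (I := A.boundaryIdeal)).2 ⟨c, hc, e⟩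

/-- The `k`-algebra `H0` is, as a `k`-module, the homology in degree `0`. -/
noncomputable def homologyZeroEquiv : A.Homology 0 ≃ₗ[k] A.H0 :=
  LinearEquiv.ofBijective
    (Submodule.liftQ _
      ((Ideal.Quotient.mkₐ k A.boundaryIdeal).toLinearMap ∘ₗ
        Submodule.inclusion (A.cycles_le_deg 0))
      (by
        rintro ⟨a, ha⟩ h
        exact (Ideal.Quotient.eq_zero_iff_mem (I := A.boundaryIdeal)).2 h))
    (by
      constructor
      · rw [← LinearMap.ker_eq_bot, LinearMap.ker_eq_bot']
        intro x hx
        obtain ⟨⟨a, ha⟩, rfl⟩ := Submodule.Quotient.mk_surjective _ x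
        refine (Submodule.Quotient.mk_eq_zero _).2 ?_
        exact (Ideal.Quotient.eq_zero_iff_mem (I := A.boundaryIdeal)).1 hx
      · intro x
        obtain ⟨⟨a, ha⟩, rfl⟩ := Ideal.Quotient.mk_surjective x
        exact ⟨Submodule.Quotient.mk ⟨a, ha, A.D_deg_zero a ha⟩, rfl⟩)

end

namespace Hom
variable {k : Type v} [CommRing k] {A : DGAlg.{v, w} k} {B : DGAlg.{v, w'} k} (φ : A.Hom B)

lemma map_cycles {n : ℕ} {a : A.carrier} (ha : a ∈ A.cycles n) : φ.toAlgHom a ∈ B.cycles n :=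
  ⟨φ.map_deg n a ha.1, by
    have h : A.D a = 0 := ha.2
    exact LinearMap.mem_ker.2 (by rw [← φ.map_D, h, map_zero])⟩

lemma map_boundaries {n : ℕ} {a : A.carrier} (ha : a ∈ A.boundaries n) :
    φ.toAlgHom a ∈ B.boundaries n := by
  obtain ⟨c, hc, rfl⟩ := ha
  exact ⟨φ.toAlgHom c, φ.map_deg _ c hc, (φ.map_D c).symm⟩

/-- The map induced on homology. -/
noncomputable def homologyMap (n : ℕ) : A.Homology n →ₗ[k] B.Homology n :=
  Submodule.mapQ _ _ (φ.toAlgHom.toLinearMap.restrict fun _ h => φ.map_cycles h)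
    fun _ h => φ.map_boundaries h

/-- The restriction to the algebras of elements of degree `0`. -/
def degZero : A.deg 0 →ₐ[k] B.deg 0 where
  toFun a := ⟨φ.toAlgHom a, φ.map_deg 0 _ a.2⟩
  map_one' := Subtype.ext (map_one φ.toAlgHom)
  map_mul' a b := Subtype.ext (map_mul φ.toAlgHom (a : A.carrier) b)
  map_zero' := Subtype.ext (map_zero φ.toAlgHom)
  map_add' a b := Subtype.ext (map_add φ.toAlgHom (a : A.carrier) b)
  commutes' r := Subtype.ext (φ.toAlgHom.commutes r)

/-- The algebra map induced on homology in degree `0`. -/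
noncomputable def H0Map : A.H0 →ₐ[k] B.H0 :=
  Ideal.Quotient.liftₐ A.boundaryIdeal ((Ideal.Quotient.mkₐ k B.boundaryIdeal).comp φ.degZero)
    fun _ h => (Ideal.Quotient.eq_zero_iff_mem (I := B.boundaryIdeal)).2 (φ.map_boundaries h)

lemma homologyZeroEquiv_homologyMap (a : A.Homology 0) :
    B.homologyZeroEquiv (φ.homologyMap 0 a) = φ.H0Map (A.homologyZeroEquiv a) := by
  obtain ⟨a, rfl⟩ := Submodule.Quotient.mk_surjective _ a
  rfl

/-- A quasi-isomorphism: a morphism inducing an isomorphism on homology in every degree. -/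
def IsQuasiIso : Prop := ∀ n, Function.Bijective (φ.homologyMap n)

end Hom
end DGAlg

/-! ### Connected differential graded coalgebras and the cobar construction -/

/-- A connected counital coassociative differential graded coalgebra over `k`: graded in degrees
`≥ 0`, with differential `d` of degree `-1`, with `Δ p q n : C n → C p ⊗ C q` the component of the
coproduct in bidegree `(p, q)` (zero unless `p + q = n`), and with a counit which identifies `C 0`
with `k`. -/
structure ConnDGCoalg (k : Type v) [CommRing k] where
  C : ℕ → Type w
  [addCommGroup : ∀ n, AddCommGroup (C n)]
  [module : ∀ n, Module k (C n)]
  d : ∀ n, C (n + 1) →ₗ[k] C n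
  Δ : ∀ p q n, C n →ₗ[k] C p ⊗[k] C q
  counit : C 0 ≃ₗ[k] k
  d_d : ∀ n x, d n (d (n + 1) x) = 0
  Δ_eq_zero : ∀ p q n, p + q ≠ n → Δ p q n = 0
  coassoc : ∀ a b c x,
    TensorProduct.assoc k (C a) (C b) (C c)
      ((Δ a b (a + b)).rTensor (C c) (Δ (a + b) c (a + b + c) x)) =
      (Δ b c (b + c)).lTensor (C a) (Δ a (b + c) (a + b + c) x)
  Δ_d : ∀ p q x,
    Δ p q (p + q) (d (p + q) x) =
      (d p).rTensor (C q) (Δ (p + 1) q (p + q + 1) x) +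
        (-1 : k) ^ p • (d q).lTensor (C p) (Δ p (q + 1) (p + q + 1) x)
  counit_d : ∀ x, counit (d 0 x) = 0
  counit_left : ∀ n x,
    TensorProduct.lid k (C n) (counit.toLinearMap.rTensor (C n) (Δ 0 n n x)) = x
  counit_right : ∀ n x,
    TensorProduct.rid k (C n) (counit.toLinearMap.lTensor (C n) (Δ n 0 n x)) = x

attribute [instance] ConnDGCoalg.addCommGroup ConnDGCoalg.module

/-- A morphism of connected differential graded coalgebras. -/
structure ConnDGCoalg.Hom {k : Type v} [CommRing k] (A : ConnDGCoalg.{v, w} k)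
    (B : ConnDGCoalg.{v, w'} k) where
  f : ∀ n, A.C n →ₗ[k] B.C n
  f_d : ∀ n x, f n (A.d n x) = B.d n (f (n + 1) x)
  f_Δ : ∀ p q n x, TensorProduct.map (f p) (f q) (A.Δ p q n x) = B.Δ p q n (f n x)
  f_counit : ∀ x, B.counit (f 0 x) = A.counit x

namespace ConnDGCoalg

section
variable {k : Type v} [CommRing k] (A : ConnDGCoalg.{v, w} k)

/-- The underlying algebra of the cobar construction: the tensor algebra on the desuspension of the
positive degree part of `A`. -/
abbrev CobarAlg : Type (max v w) := TensorAlgebra k (⨁ n : ℕ, A.C (n + 1))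

/-- The desuspension `s⁻¹ : A.C (n + 1) → CobarAlg A`; its image lies in degree `n`. -/
noncomputable def gen (n : ℕ) : A.C (n + 1) →ₗ[k] A.CobarAlg :=
  TensorAlgebra.ι k ∘ₗ DirectSum.lof k ℕ (fun n => A.C (n + 1)) n

/-- The linear map `x ⊗ y ↦ s⁻¹x · s⁻¹y`. -/
noncomputable def gen₂ (p q : ℕ) : A.C (p + 1) ⊗[k] A.C (q + 1) →ₗ[k] A.CobarAlg :=
  LinearMap.mul' k A.CobarAlg ∘ₗ TensorProduct.map (A.gen p) (A.gen q)

@[simp] lemma gen₂_tmul (p q : ℕ) (x : A.C (p + 1)) (y : A.C (q + 1)) :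
    A.gen₂ p q (x ⊗ₜ y) = A.gen p x * A.gen q y := by simp [gen₂]

variable {A} in
/-- The algebra map out of the cobar construction with given values on generators. -/
noncomputable def lift {B : Type*} [Semiring B] [Algebra k B] (g : ∀ n, A.C (n + 1) →ₗ[k] B) :
    A.CobarAlg →ₐ[k] B :=
  TensorAlgebra.lift k (DirectSum.toModule k ℕ B g)

variable {A} in
@[simp] lemma lift_gen {B : Type*} [Semiring B] [Algebra k B] (g : ∀ n, A.C (n + 1) →ₗ[k] B)
    (n : ℕ) (x : A.C (n + 1)) : lift g (A.gen n x) = g n x := by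
  simp [lift, gen]

lemma cobar_induction {P : A.CobarAlg → Prop} (h0 : ∀ r, P (algebraMap k _ r))
    (h1 : ∀ n x, P (A.gen n x)) (hm : ∀ a b, P a → P b → P (a * b))
    (ha : ∀ a b, P a → P b → P (a + b)) (a : A.CobarAlg) : P a := by
  induction a using TensorAlgebra.induction with
  | algebraMap r => exact h0 r
  | ι x =>
    induction x using DirectSum.induction_on with
    | zero => simpa using! h0 0
    | of n x => exact h1 n x
    | add x y hx hy => rw [map_add]; exact ha _ _ hx hy
  | mul a b h h' => exact hm a b h h'
  | add a b h h' => exact ha a b h h'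

/-- The sign involution `a ↦ (-1)^|a| a`. -/
noncomputable def sgn : A.CobarAlg →ₐ[k] A.CobarAlg := lift fun n => (-1 : k) ^ n • A.gen n

@[simp] lemma sgn_gen (n : ℕ) (x : A.C (n + 1)) : A.sgn (A.gen n x) = (-1 : k) ^ n • A.gen n x := by
  simp [sgn]

/-- The differential on generators, `-s⁻¹ ∘ ∂ ∘ s + (s⁻¹ ⊗ s⁻¹) ∘ Δ ∘ s`. By the Koszul rule
`(s⁻¹ ⊗ s⁻¹)(x ⊗ y) = (-1)^|x| s⁻¹x ⊗ s⁻¹y`; here `|x| = p + 1`. -/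
noncomputable def genD : ∀ n, A.C (n + 1) →ₗ[k] A.CobarAlg
  | 0 => 0
  | n + 1 => -(A.gen n ∘ₗ A.d (n + 1)) +
      ∑ pq ∈ Finset.HasAntidiagonal.antidiagonal n,
        (-1 : k) ^ (pq.1 + 1) • A.gen₂ pq.1 pq.2 ∘ₗ A.Δ (pq.1 + 1) (pq.2 + 1) (n + 2)

/-- An auxiliary algebra map, `a ↦ !![sgn a, D a; 0, a]`: its upper right entry is the unique
extension `D` of `genD` such that `D (a * b) = D a * b + sgn a * D b`. -/
noncomputable def matD : A.CobarAlg →ₐ[k] Matrix (Fin 2) (Fin 2) A.CobarAlg :=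
  lift fun n =>
    { toFun := fun x => !![(-1 : k) ^ n • A.gen n x, A.genD n x; 0, A.gen n x]
      map_add' := fun x y => by ext i j; fin_cases i <;> fin_cases j <;> simp
      map_smul' := fun r x => by
        ext i j; fin_cases i <;> fin_cases j <;> simp [smul_comm r] }

/-- The differential of the cobar construction. -/
noncomputable def cobarD : A.CobarAlg →ₗ[k] A.CobarAlg where
  toFun a := A.matD a 0 1
  map_add' a b := by simp
  map_smul' r a := by simp

lemma matD_eq (a : A.CobarAlg) : A.matD a 0 0 = A.sgn a ∧ A.matD a 1 0 = 0 ∧ A.matD a 1 1 = a := by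
  induction a using A.cobar_induction with
  | h0 r => simp [Matrix.algebraMap_matrix_apply]
  | h1 n x => simp [matD]
  | hm a b h h' =>
    obtain ⟨h1, h2, h3⟩ := h
    obtain ⟨h1', h2', h3'⟩ := h'
    simp [Matrix.mul_apply, Fin.sum_univ_two, *]
  | ha a b h h' => simp [h, h']

@[simp] lemma cobarD_gen (n : ℕ) (x : A.C (n + 1)) : A.cobarD (A.gen n x) = A.genD n x := by
  simp [cobarD, matD]

lemma cobarD_mul (a b : A.CobarAlg) :
    A.cobarD (a * b) = A.cobarD a * b + A.sgn a * A.cobarD b := by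
  change A.matD (a * b) 0 1 = A.matD a 0 1 * b + A.sgn a * A.matD b 0 1
  rw [map_mul, Matrix.mul_apply, Fin.sum_univ_two, (A.matD_eq a).1, (A.matD_eq b).2.2, add_comm]

@[simp] lemma cobarD_algebraMap (r : k) : A.cobarD (algebraMap k _ r) = 0 := by
  change A.matD (algebraMap k _ r) 0 1 = 0
  simp [Matrix.algebraMap_matrix_apply]

/-- The homogeneous elements of degree `n` of the cobar construction: the span of the monomials
`s⁻¹x₁ ⋯ s⁻¹xᵣ` with `∑ (|xᵢ| - 1) = n`. -/
def cobarDeg (n : ℕ) : Submodule k A.CobarAlg :=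
  Submodule.span k {a | ∃ l : List (Σ m, A.C (m + 1)),
    (l.map Sigma.fst).sum = n ∧ a = (l.map fun g => A.gen g.1 g.2).prod}

variable {A}

lemma gen_mem (n : ℕ) (x : A.C (n + 1)) : A.gen n x ∈ A.cobarDeg n :=
  Submodule.subset_span ⟨[⟨n, x⟩], by simp⟩

lemma one_mem_cobarDeg : (1 : A.CobarAlg) ∈ A.cobarDeg 0 :=
  Submodule.subset_span ⟨[], by simp⟩

lemma mul_mem_cobarDeg {m n : ℕ} {a b : A.CobarAlg} (ha : a ∈ A.cobarDeg m)
    (hb : b ∈ A.cobarDeg n) : a * b ∈ A.cobarDeg (m + n) := by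
  have := Submodule.mul_mem_mul ha hb
  rw [cobarDeg, cobarDeg, Submodule.span_mul_span] at this
  refine Submodule.span_mono ?_ this
  rintro _ ⟨_, ⟨l, hl, rfl⟩, _, ⟨l', hl', rfl⟩, rfl⟩
  exact ⟨l ++ l', by simp [hl, hl'], by simp⟩

instance : SetLike.GradedMonoid A.cobarDeg where
  one_mem := one_mem_cobarDeg
  mul_mem _ _ _ _ := mul_mem_cobarDeg

/-- Induction on homogeneous elements. -/
lemma cobarDeg_induction {P : ∀ n a, a ∈ A.cobarDeg n → Prop} (h0 : ∀ n, P n 0 (zero_mem _))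
    (h1 : P 0 1 one_mem_cobarDeg)
    (hg : ∀ m n x a h, P n a h → P (m + n) (A.gen m x * a) (mul_mem_cobarDeg (gen_mem m x) h))
    (ha : ∀ n a b h h', P n a h → P n b h' → P n (a + b) (add_mem h h'))
    (hs : ∀ n (r : k) a h, P n a h → P n (r • a) (Submodule.smul_mem _ r h))
    {n : ℕ} {a : A.CobarAlg} (h : a ∈ A.cobarDeg n) : P n a h := by
  induction h using Submodule.span_induction with
  | mem a h =>
    obtain ⟨l, hl, rfl⟩ := h
    induction l generalizing n with
    | nil => subst hl; simpa using! h1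
    | cons g l ih =>
      subst hl
      exact hg _ _ _ _ (Submodule.subset_span ⟨l, rfl, rfl⟩) (ih rfl)
  | zero => exact h0 _
  | add a b _ _ h h' => exact ha _ _ _ _ _ h h'
  | smul r a _ h => exact hs _ _ _ _ h

noncomputable instance : GradedAlgebra A.cobarDeg :=
  GradedAlgebra.ofAlgHom A.cobarDeg
    (lift fun n => DirectSum.lof k ℕ (fun n => A.cobarDeg n) n ∘ₗ
      (A.gen n).codRestrict _ (gen_mem n))
    (by
      ext n x
      simp only [AlgHom.toLinearMap_apply, LinearMap.comp_apply, AlgHom.comp_apply]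
      change DirectSum.coeAlgHom A.cobarDeg (lift _ (A.gen n x)) = A.gen n x
      rw [lift_gen]
      exact DirectSum.coeAlgHom_of _ _ _)
    (by
      intro n a
      obtain ⟨a, h⟩ := a
      suffices H : ∃ h : a ∈ A.cobarDeg n, lift (fun n => DirectSum.lof k ℕ
          (fun n => A.cobarDeg n) n ∘ₗ (A.gen n).codRestrict _ (gen_mem n)) a =
          DirectSum.of (fun n => A.cobarDeg n) n ⟨a, h⟩ from H.2
      induction h using cobarDeg_induction with
      | h0 n => exact ⟨zero_mem _, by rw [map_zero]; exact (map_zero (DirectSum.of _ n)).symm⟩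
      | h1 => exact ⟨one_mem_cobarDeg, by rw [map_one]; rfl⟩
      | hg m n x a ha ih =>
        obtain ⟨h, ih⟩ := ih
        refine ⟨mul_mem_cobarDeg (gen_mem m x) h, ?_⟩
        rw [map_mul, ih, lift_gen]
        exact DirectSum.of_mul_of _ _
      | ha n a b _ _ h h' =>
        obtain ⟨h, e⟩ := h
        obtain ⟨h', e'⟩ := h'
        exact ⟨add_mem h h', by rw [map_add, e, e', ← map_add]; rfl⟩
      | hs n r a _ h =>
        obtain ⟨h, e⟩ := h
        refine ⟨Submodule.smul_mem _ r h, ?_⟩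
        rw [map_smul, e]
        exact ((DirectSum.lof k ℕ (fun n => A.cobarDeg n) n).map_smul r ⟨a, h⟩).symm)

lemma sgn_of_mem {n : ℕ} {a : A.CobarAlg} (h : a ∈ A.cobarDeg n) : A.sgn a = (-1 : k) ^ n • a := by
  induction h using cobarDeg_induction with
  | h0 n => simp
  | h1 => simp
  | hg m n x a ha ih => 
    rw [map_mul, ih, sgn_gen, smul_mul_smul_comm, pow_add]
  | ha n a b _ _ h h' => simp [h, h']
  | hs n r a _ h => rw [map_smul, h, smul_comm]

lemma gen₂_mem (p q : ℕ) (t : A.C (p + 1) ⊗[k] A.C (q + 1)) : A.gen₂ p q t ∈ A.cobarDeg (p + q) := by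
  induction t with
  | zero => simp
  | tmul x y => rw [gen₂_tmul]; exact mul_mem_cobarDeg (gen_mem p x) (gen_mem q y)
  | add x y h h' => rw [map_add]; exact add_mem h h'

lemma genD_mem (n : ℕ) (x : A.C (n + 2)) : A.genD (n + 1) x ∈ A.cobarDeg n := by
  simp only [genD, LinearMap.add_apply, LinearMap.neg_apply, LinearMap.sum_apply,
    LinearMap.smul_apply, LinearMap.comp_apply]
  refine add_mem (neg_mem (gen_mem n _)) (sum_mem fun pq h => Submodule.smul_mem _ _ ?_)
  have := gen₂_mem pq.1 pq.2 (A.Δ (pq.1 + 1) (pq.2 + 1) (n + 2) x)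
  rwa [Finset.HasAntidiagonal.mem_antidiagonal.1 h] at this

lemma cobarD_mem_aux {n : ℕ} {a : A.CobarAlg} (h : a ∈ A.cobarDeg n) :
    (n = 0 → A.cobarD a = 0) ∧ ∀ m, n = m + 1 → A.cobarD a ∈ A.cobarDeg m := by
  induction h using cobarDeg_induction with
  | h0 n => simp
  | h1 =>
    have : A.cobarD 1 = 0 := by simpa using A.cobarD_algebraMap 1
    simp [this]
  | hg m n x a ha ih =>
    obtain ⟨ih1, ih2⟩ := ih
    rw [cobarD_mul, cobarD_gen, sgn_gen]
    constructor
    · intro h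
      obtain rfl : m = 0 := by omega
      obtain rfl : n = 0 := by omega
      simp [ih1 rfl, genD]
    · intro l hl
      refine add_mem ?_ ?_
      · cases m with
        | zero => simp [genD]
        | succ m =>
          obtain rfl : l = m + n := by omega
          exact mul_mem_cobarDeg (genD_mem m x) ha
      · cases n with
        | zero => simp [ih1 rfl]
        | succ n =>
          obtain rfl : l = m + n := by omega
          exact mul_mem_cobarDeg (Submodule.smul_mem _ _ (gen_mem m x)) (ih2 n rfl)
  | ha n a b _ _ h h' =>
    exact ⟨fun e => by simp [h.1 e, h'.1 e], fun m e => by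
      rw [map_add]; exact add_mem (h.2 m e) (h'.2 m e)⟩
  | hs n r a _ h =>
    exact ⟨fun e => by simp [h.1 e], fun m e => by
      rw [map_smul]; exact Submodule.smul_mem _ _ (h.2 m e)⟩

variable (A) in
/-- The linear map `x ⊗ y ↦ f x * g y`. -/
noncomputable def mulMap {M N : Type*} [AddCommGroup M] [Module k M] [AddCommGroup N] [Module k N]
    (f : M →ₗ[k] A.CobarAlg) (g : N →ₗ[k] A.CobarAlg) : M ⊗[k] N →ₗ[k] A.CobarAlg :=
  LinearMap.mul' k A.CobarAlg ∘ₗ TensorProduct.map f g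

lemma cobarD_gen₂ (p q : ℕ) (t : A.C (p + 1) ⊗[k] A.C (q + 1)) :
    A.cobarD (A.gen₂ p q t) = A.mulMap (A.genD p) (A.gen q) t +
      (-1 : k) ^ p • A.mulMap (A.gen p) (A.genD q) t := by
  induction t with
  | zero => simp
  | tmul x y => simp [mulMap, cobarD_mul]
  | add x y h h' => simp only [map_add, h, h', smul_add]; abel

lemma mulMap_genD_left (p q : ℕ) (t : A.C (p + 2) ⊗[k] A.C (q + 1)) :
    A.mulMap (A.genD (p + 1)) (A.gen q) t = -A.gen₂ p q ((A.d (p + 1)).rTensor _ t) +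
      ∑ ab ∈ Finset.HasAntidiagonal.antidiagonal p, (-1 : k) ^ (ab.1 + 1) •
        A.mulMap (A.gen₂ ab.1 ab.2) (A.gen q)
          ((A.Δ (ab.1 + 1) (ab.2 + 1) (p + 2)).rTensor _ t) := by
  induction t with
  | zero => simp
  | tmul x y => simp [mulMap, genD, add_mul, Finset.sum_mul]
  | add x y h h' => simp only [map_add, h, h', smul_add, Finset.sum_add_distrib]; abel

lemma mulMap_genD_right (p q : ℕ) (t : A.C (p + 1) ⊗[k] A.C (q + 2)) :
    A.mulMap (A.gen p) (A.genD (q + 1)) t = -A.gen₂ p q ((A.d (q + 1)).lTensor _ t) +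
      ∑ ab ∈ Finset.HasAntidiagonal.antidiagonal q, (-1 : k) ^ (ab.1 + 1) •
        A.mulMap (A.gen p) (A.gen₂ ab.1 ab.2)
          ((A.Δ (ab.1 + 1) (ab.2 + 1) (q + 2)).lTensor _ t) := by
  induction t with
  | zero => simp
  | tmul x y => simp [mulMap, genD, mul_add, Finset.mul_sum]
  | add x y h h' => simp only [map_add, h, h', smul_add, Finset.sum_add_distrib]; abel

lemma mulMap_zero_left {M N : Type*} [AddCommGroup M] [Module k M] [AddCommGroup N] [Module k N]
    (g : N →ₗ[k] A.CobarAlg) : A.mulMap (0 : M →ₗ[k] A.CobarAlg) g = 0 := by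
  simp [mulMap]

lemma mulMap_zero_right {M N : Type*} [AddCommGroup M] [Module k M] [AddCommGroup N] [Module k N]
    (f : M →ₗ[k] A.CobarAlg) : A.mulMap f (0 : N →ₗ[k] A.CobarAlg) = 0 := by
  simp [mulMap]

lemma mulMap_assoc (a b c : ℕ) (t : (A.C (a + 1) ⊗[k] A.C (b + 1)) ⊗[k] A.C (c + 1)) :
    A.mulMap (A.gen₂ a b) (A.gen c) t =
      A.mulMap (A.gen a) (A.gen₂ b c) (TensorProduct.assoc k _ _ _ t) := by
  induction t with
  | zero => simp
  | tmul x y =>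
    induction x with
    | zero => simp
    | tmul x z => simp [mulMap, mul_assoc]
    | add x y h h' => simp only [TensorProduct.add_tmul, map_add, h, h']
  | add x y h h' => simp only [map_add, h, h']

variable (A) in
lemma coassoc' (a b c p q n : ℕ) (hp : p = a + b) (hq : q = b + c) (hn : n = a + b + c) (x : A.C n) :
    TensorProduct.assoc k (A.C a) (A.C b) (A.C c)
      ((A.Δ a b p).rTensor (A.C c) (A.Δ p c n x)) =
      (A.Δ b c q).lTensor (A.C a) (A.Δ a q n x) := by
  subst hp hq hn
  exact A.coassoc a b c x

variable (A) in
lemma Δ_d' (p q n : ℕ) (hn : n = p + q) (x : A.C (n + 1)) :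
    A.Δ p q n (A.d n x) =
      (A.d p).rTensor (A.C q) (A.Δ (p + 1) q (n + 1) x) +
        (-1 : k) ^ p • (A.d q).lTensor (A.C p) (A.Δ p (q + 1) (n + 1) x) := by
  subst hn
  exact A.Δ_d p q x

lemma sum_antidiagonal_assoc {M : Type*} [AddCommMonoid M] (n : ℕ) (F : ℕ → ℕ → ℕ → M) :
    ∑ pq ∈ Finset.HasAntidiagonal.antidiagonal n,
      ∑ ab ∈ Finset.HasAntidiagonal.antidiagonal pq.1, F ab.1 ab.2 pq.2 =
    ∑ pq ∈ Finset.HasAntidiagonal.antidiagonal n,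
      ∑ ab ∈ Finset.HasAntidiagonal.antidiagonal pq.2, F pq.1 ab.1 ab.2 := by
  rw [Finset.sum_sigma', Finset.sum_sigma']
  refine Finset.sum_nbij' (fun s => ⟨(s.2.1, s.2.2 + s.1.2), (s.2.2, s.1.2)⟩)
    (fun s => ⟨(s.1.1 + s.2.1, s.2.2), (s.1.1, s.2.1)⟩) ?_ ?_ ?_ ?_ ?_
  all_goals
    rintro ⟨⟨p, q⟩, ⟨a, b⟩⟩ h
    simp only [Finset.mem_sigma, Finset.HasAntidiagonal.mem_antidiagonal] at h ⊢
  · exact ⟨by omega, trivial⟩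
  · exact ⟨by omega, trivial⟩
  · obtain ⟨h, rfl⟩ := h; rfl
  · obtain ⟨h, rfl⟩ := h; rfl

lemma cobarD_genD (n : ℕ) (x : A.C (n + 1)) : A.cobarD (A.genD n x) = 0 := by
  obtain _ | _ | l := n
  · simp [genD]
  · simp [genD, cobarD_gen₂, mulMap_zero_left, mulMap_zero_right]
  simp only [genD.eq_2, LinearMap.add_apply, LinearMap.neg_apply, LinearMap.sum_apply,
    LinearMap.smul_apply, LinearMap.comp_apply, map_add, map_neg, map_sum, map_smul, cobarD_gen,
    cobarD_gen₂, smul_add, Finset.sum_add_distrib, A.d_d, map_zero, neg_zero, zero_add]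
  rw [Finset.Nat.sum_antidiagonal_succ, Finset.Nat.sum_antidiagonal_succ']
  simp only [genD.eq_1, mulMap_zero_left, mulMap_zero_right, LinearMap.zero_apply, smul_zero,
    zero_add, mulMap_genD_left, mulMap_genD_right, smul_add, Finset.sum_add_distrib,
    Finset.smul_sum]
  have h1 : ∑ pq ∈ Finset.HasAntidiagonal.antidiagonal l, (-1 : k) ^ (pq.1 + 1) •
        A.gen₂ pq.1 pq.2 (A.Δ (pq.1 + 1) (pq.2 + 1) (l + 2) (A.d (l + 2) x)) =
      ∑ pq ∈ Finset.HasAntidiagonal.antidiagonal l, ((-1 : k) ^ (pq.1 + 1 + 1) •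
        -A.gen₂ pq.1 pq.2 ((A.d (pq.1 + 1)).rTensor _
          (A.Δ (pq.1 + 1 + 1) (pq.2 + 1) (l + 1 + 2) x)) +
      (-1 : k) ^ (pq.1 + 1) • (-1 : k) ^ pq.1 • -A.gen₂ pq.1 pq.2 ((A.d (pq.2 + 1)).lTensor _
          (A.Δ (pq.1 + 1) (pq.2 + 1 + 1) (l + 1 + 2) x))) := by
    refine Finset.sum_congr rfl fun pq h => ?_
    rw [Finset.HasAntidiagonal.mem_antidiagonal] at h
    rw [Δ_d' A (pq.1 + 1) (pq.2 + 1) (l + 2) (by omega), map_add, map_smul, smul_add]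
    congr 1
    · rw [pow_succ _ (pq.1 + 1)]; simp
    · rw [pow_succ _ pq.1]; simp
  have h2 : ∑ pq ∈ Finset.HasAntidiagonal.antidiagonal l,
        ∑ ab ∈ Finset.HasAntidiagonal.antidiagonal pq.1,
          (-1 : k) ^ (pq.1 + 1 + 1) • (-1 : k) ^ (ab.1 + 1) •
          A.mulMap (A.gen₂ ab.1 ab.2) (A.gen pq.2)
            ((A.Δ (ab.1 + 1) (ab.2 + 1) (pq.1 + 2)).rTensor _
              (A.Δ (pq.1 + 1 + 1) (pq.2 + 1) (l + 1 + 2) x)) =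
      -∑ pq ∈ Finset.HasAntidiagonal.antidiagonal l,
        ∑ ab ∈ Finset.HasAntidiagonal.antidiagonal pq.2,
          (-1 : k) ^ (pq.1 + 1) • (-1 : k) ^ pq.1 • (-1 : k) ^ (ab.1 + 1) •
          A.mulMap (A.gen pq.1) (A.gen₂ ab.1 ab.2)
            ((A.Δ (ab.1 + 1) (ab.2 + 1) (pq.2 + 2)).lTensor _
              (A.Δ (pq.1 + 1) (pq.2 + 1 + 1) (l + 1 + 2) x)) := by
    have e1 := sum_antidiagonal_assoc l fun a b c => (-1 : k) ^ (b + 1) •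
      A.mulMap (A.gen a) (A.gen₂ b c) ((A.Δ (b + 1) (c + 1) (b + c + 2)).lTensor _
              (A.Δ (a + 1) (b + c + 2) (l + 1 + 2) x))
    rw [← Finset.sum_neg_distrib]
    refine Eq.trans (Finset.sum_congr rfl fun pq h => Finset.sum_congr rfl fun ab h' => ?_)
      (e1.trans (Finset.sum_congr rfl fun pq h => ?_))
    · rw [Finset.HasAntidiagonal.mem_antidiagonal] at h h'
      obtain ⟨p, q⟩ := pq
      obtain ⟨a, b⟩ := ab
      dsimp only at h h' ⊢
      subst h'
      rw [mulMap_assoc, coassoc' A (a + 1) (b + 1) (q + 1) (a + b + 2) (b + q + 2) (l + 1 + 2)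
        (by omega) (by omega) (by omega), smul_smul]
      congr 1
      rw [← pow_add, show a + b + 1 + 1 + (a + 1) = 2 * (a + 1) + (b + 1) by ring, pow_add, pow_mul]
      simp
    · rw [← Finset.sum_neg_distrib]
      refine Finset.sum_congr rfl fun ab h' => ?_
      rw [Finset.HasAntidiagonal.mem_antidiagonal] at h h'
      obtain ⟨p, q⟩ := pq
      obtain ⟨a, b⟩ := ab
      dsimp only at h h' ⊢
      subst h'
      rw [smul_smul, smul_smul, ← neg_smul]
      congr 1
      have e : (-1 : k) ^ p * (-1) ^ p = 1 := by rw [← mul_pow]; simp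
      linear_combination (-1 : k) ^ a * e
  rw [h1, h2, Finset.sum_add_distrib]
  abel

lemma cobarD_cobarD (a : A.CobarAlg) : A.cobarD (A.cobarD a) = 0 := by
  have hs : ∀ a, A.cobarD (A.sgn a) = -A.sgn (A.cobarD a) := by
    have hg : ∀ n x, A.sgn (A.genD (n + 1) x) = (-1 : k) ^ n • A.genD (n + 1) x :=
      fun n x => sgn_of_mem (genD_mem n x)
    intro a
    induction a using A.cobar_induction with
    | h0 r => simp
    | h1 n x =>
      rw [sgn_gen, map_smul, cobarD_gen]
      cases n with
      | zero => simp [genD]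
      | succ n => rw [hg, pow_succ]; simp
    | hm a b h h' => simp only [map_mul, cobarD_mul, map_add, h, h']; simp [add_comm]
    | ha a b h h' => simp only [map_add, h, h', neg_add]
  induction a using A.cobar_induction with
  | h0 r => simp
  | h1 n x => rw [cobarD_gen, cobarD_genD]
  | hm a b h h' => simp [cobarD_mul, h, h', hs]
  | ha a b h h' => simp [h, h']

variable (A) in
/-- The cobar construction. -/
noncomputable def cobar : DGAlg.{v, max v w} k where
  carrier := A.CobarAlg
  deg := A.cobarDeg
  D := A.cobarD
  D_deg_zero _ h := (cobarD_mem_aux h).1 rfl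
  D_deg_succ n _ h := (cobarD_mem_aux h).2 n rfl
  D_D := cobarD_cobarD
  leibniz n a h b := by rw [cobarD_mul, sgn_of_mem h, smul_mul_assoc]

end

namespace Hom
variable {k : Type v} [CommRing k] {A : ConnDGCoalg.{v, w} k} {B : ConnDGCoalg.{v, w'} k}
  (φ : A.Hom B)

/-- The algebra map `T(s⁻¹φ)`. -/
noncomputable def cobarAlgHom : A.CobarAlg →ₐ[k] B.CobarAlg :=
  lift fun n => B.gen n ∘ₗ φ.f (n + 1)

@[simp] lemma cobarAlgHom_gen (n : ℕ) (x : A.C (n + 1)) :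
    φ.cobarAlgHom (A.gen n x) = B.gen n (φ.f (n + 1) x) := by
  simp [cobarAlgHom]

lemma cobarAlgHom_gen₂ (p q : ℕ) (t : A.C (p + 1) ⊗[k] A.C (q + 1)) :
    φ.cobarAlgHom (A.gen₂ p q t) =
      B.gen₂ p q (TensorProduct.map (φ.f (p + 1)) (φ.f (q + 1)) t) := by
  induction t with
  | zero => simp
  | tmul x y => simp
  | add x y h h' => simp only [map_add, h, h']

lemma cobarAlgHom_sgn (a : A.CobarAlg) : φ.cobarAlgHom (A.sgn a) = B.sgn (φ.cobarAlgHom a) := by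
  induction a using A.cobar_induction with
  | h0 r => simp
  | h1 n x => simp
  | hm a b h h' => simp [h, h']
  | ha a b h h' => simp [h, h']

lemma cobarAlgHom_D (a : A.CobarAlg) :
    φ.cobarAlgHom (A.cobarD a) = B.cobarD (φ.cobarAlgHom a) := by
  induction a using A.cobar_induction with
  | h0 r => simp
  | h1 n x =>
    cases n with
    | zero => simp [genD]
    | succ n => simp [genD, cobarAlgHom_gen₂, φ.f_d, φ.f_Δ]
  | hm a b h h' => simp [cobarD_mul, h, h', cobarAlgHom_sgn]
  | ha a b h h' => simp [h, h']

/-- Functoriality of the cobar construction. -/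
noncomputable def cobar : A.cobar.Hom B.cobar where
  toAlgHom := φ.cobarAlgHom
  map_deg n a h := by
    change φ.cobarAlgHom a ∈ B.cobarDeg n
    change a ∈ A.cobarDeg n at h
    induction h using cobarDeg_induction with
    | h0 n => simp
    | h1 => simpa using! one_mem_cobarDeg
    | hg m n x a _ h =>
      rw [map_mul, cobarAlgHom_gen]
      exact mul_mem_cobarDeg (gen_mem m _) h
    | ha n a b _ _ h h' => rw [map_add]; exact add_mem h h'
    | hs n r a _ h => rw [map_smul]; exact Submodule.smul_mem _ r h
  map_D := φ.cobarAlgHom_D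

/-- A morphism of connected dg coalgebras is an `Ω`-quasi-isomorphism if the cobar construction
turns it into a quasi-isomorphism of dg algebras. -/
def IsOmegaQuasiIso : Prop := φ.cobar.IsQuasiIso

end Hom
end ConnDGCoalg

/-! ### Normalized chains of a simplicial set -/

section Chains

open Simplicial

/-- Normalized `n`-chains: the free module on the `n`-simplices, modulo the degenerate ones. -/
def NormChains (k : Type v) [CommRing k] (S : SSet.{u}) (n : ℕ) : Type (max u v) :=
  (S _⦋n⦌ →₀ k) ⧸ Submodule.span k ((fun σ => Finsupp.single σ (1 : k)) '' S.degenerate n)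

namespace NormChains
variable {k : Type v} [CommRing k] {S : SSet.{u}}

noncomputable instance (n : ℕ) : AddCommGroup (NormChains k S n) :=
  inferInstanceAs (AddCommGroup ((S _⦋n⦌ →₀ k) ⧸
    Submodule.span k ((fun σ => Finsupp.single σ (1 : k)) '' S.degenerate n)))

noncomputable instance (n : ℕ) : Module k (NormChains k S n) :=
  inferInstanceAs (Module k ((S _⦋n⦌ →₀ k) ⧸
    Submodule.span k ((fun σ => Finsupp.single σ (1 : k)) '' S.degenerate n)))

variable (k) in
/-- The class of a simplex. -/
noncomputable def mk {n : ℕ} (σ : S _⦋n⦌) : NormChains k S n :=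
  Submodule.Quotient.mk (Finsupp.single σ 1)

lemma mk_eq_zero {n : ℕ} {σ : S _⦋n⦌} (h : σ ∈ S.degenerate n) : mk k σ = 0 :=
  (Submodule.Quotient.mk_eq_zero _).2 (Submodule.subset_span ⟨σ, h, rfl⟩)

/-- The linear map with prescribed values on simplices, zero on the degenerate ones. -/
noncomputable def lift {M : Type*} [AddCommGroup M] [Module k M] {n : ℕ} (g : S _⦋n⦌ → M)
    (hg : ∀ σ ∈ S.degenerate n, g σ = 0) : NormChains k S n →ₗ[k] M :=
  Submodule.liftQ _ (Finsupp.linearCombination k g) (by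
    rw [Submodule.span_le]
    rintro _ ⟨σ, h, rfl⟩
    simpa using! hg σ h)

@[simp] lemma lift_mk {M : Type*} [AddCommGroup M] [Module k M] {n : ℕ} (g : S _⦋n⦌ → M)
    (hg : ∀ σ ∈ S.degenerate n, g σ = 0) (σ : S _⦋n⦌) : lift g hg (mk k σ) = g σ := by
  simp only [lift, mk]
  exact (Submodule.liftQ_apply _ _ _).trans (by simp)

lemma hom_ext {M : Type*} [AddCommGroup M] [Module k M] {n : ℕ} {f g : NormChains k S n →ₗ[k] M}
    (h : ∀ σ, f (mk k σ) = g (mk k σ)) : f = g := by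
  refine Submodule.linearMap_qext _ (Finsupp.lhom_ext' fun σ => LinearMap.ext_ring ?_)
  exact h σ

lemma map_mem_degenerate {n m : ℕ} (g : ⦋n⦌ ⟶ ⦋m⦌) (i j : Fin (n + 1)) (hij : i ≠ j)
    (h : g.toOrderHom i = g.toOrderHom j) (y : S _⦋m⦌) : S.map g.op y ∈ S.degenerate n := by
  cases n with
  | zero => omega
  | succ n =>
    obtain ⟨l, g', rfl⟩ := SimplexCategory.eq_σ_comp_of_not_injective g fun H => hij (H h)
    rw [op_comp, S.map_comp]
    exact SSet.σ_mem_degenerate S l (S.map g'.op y)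

lemma σ_eq {n : ℕ} (j : Fin (n + 1)) (a b : Fin (n + 2)) (ha : (a : ℕ) = j) (hb : (b : ℕ) = j + 1) :
    (SimplexCategory.σ j).toOrderHom a = (SimplexCategory.σ j).toOrderHom b := by
  obtain rfl : a = j.castSucc := Fin.ext ha
  obtain rfl : b = j.succ := Fin.ext hb
  exact (Fin.predAbove_castSucc_self j).trans (Fin.predAbove_succ_self j).symm

lemma map_map_eq {a b b' c : ℕ} (f : ⦋a⦌ ⟶ ⦋b⦌) (g : ⦋b⦌ ⟶ ⦋c⦌) (f' : ⦋a⦌ ⟶ ⦋b'⦌) (g' : ⦋b'⦌ ⟶ ⦋c⦌)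
    (h : ∀ i, (g.toOrderHom (f.toOrderHom i) : ℕ) = g'.toOrderHom (f'.toOrderHom i)) (y : S _⦋c⦌) :
    S.map f.op (S.map g.op y) = S.map f'.op (S.map g'.op y) := by
  have e : f ≫ g = f' ≫ g' := by
    ext i : 3
    exact Fin.ext (h i)
  rw [← Functor.map_comp_apply, ← Functor.map_comp_apply, ← op_comp, ← op_comp, e]

lemma map_map_eq' {a b c : ℕ} (f : ⦋a⦌ ⟶ ⦋b⦌) (g : ⦋b⦌ ⟶ ⦋c⦌) (f' : ⦋a⦌ ⟶ ⦋c⦌)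
    (h : ∀ i, (g.toOrderHom (f.toOrderHom i) : ℕ) = f'.toOrderHom i) (y : S _⦋c⦌) :
    S.map f.op (S.map g.op y) = S.map f'.op y := by
  have e : f ≫ g = f' := by
    ext i : 3
    exact Fin.ext (h i)
  rw [← Functor.map_comp_apply, ← op_comp, e]

variable (k S) in
/-- The differential `∂σ = ∑ (-1)^i d_i σ`. -/
noncomputable def d (n : ℕ) : NormChains k S (n + 1) →ₗ[k] NormChains k S n :=
  lift (fun σ => ∑ i : Fin (n + 2), (-1 : k) ^ (i : ℕ) • mk k (S.δ i σ)) (by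
    intro σ h
    rw [SSet.degenerate_eq_iUnion_range_σ] at h
    simp only [Set.mem_iUnion, Set.mem_range] at h
    obtain ⟨j, y, rfl⟩ := h
    rw [Finset.sum_eq_add j.castSucc j.succ (Fin.castSucc_lt_succ).ne]
    · rw [SSet.δ_comp_σ_self_apply, SSet.δ_comp_σ_succ_apply, ← add_smul]
      simp [pow_succ]
    · rintro i - ⟨h1, h2⟩
      rw [mk_eq_zero, smul_zero]
      obtain ⟨a, ha⟩ := Fin.exists_succAbove_eq h1.symm
      obtain ⟨b, hb⟩ := Fin.exists_succAbove_eq h2.symm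
      have hab : a ≠ b := by
        rintro rfl
        exact (Fin.castSucc_lt_succ (i := j)).ne (ha.symm.trans hb)
      have := map_mem_degenerate (SimplexCategory.δ i ≫ SimplexCategory.σ j) a b hab
        (σ_eq j (i.succAbove a) (i.succAbove b) (by rw [ha]; rfl) (by rw [hb]; rfl)) y
      rwa [op_comp, S.map_comp] at this
    · simp
    · simp)

@[simp] lemma d_mk (n : ℕ) (σ : S _⦋n + 1⦌) :
    d k S n (mk k σ) = ∑ i : Fin (n + 2), (-1 : k) ^ (i : ℕ) • mk k (S.δ i σ) := by
  simp [d]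

/-- The front face `σ|[0, …, p]`. -/
def front (p : ℕ) {n : ℕ} (h : p ≤ n) (σ : S _⦋n⦌) : S _⦋p⦌ :=
  S.map (SimplexCategory.subinterval 0 p (by omega)).op σ

/-- The back face `σ|[p, …, p + q]`. -/
def back (p q : ℕ) {n : ℕ} (h : p + q = n) (σ : S _⦋n⦌) : S _⦋q⦌ :=
  S.map (SimplexCategory.subinterval p q h.le).op σ

variable (k S) in
/-- The component `C_n → C_p ⊗ C_q` of the Alexander-Whitney coproduct. -/
noncomputable def Δ (p q n : ℕ) : NormChains k S n →ₗ[k] NormChains k S p ⊗[k] NormChains k S q :=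
  if h : p + q = n then
    lift (fun σ => mk k (front p (by omega) σ) ⊗ₜ mk k (back p q h σ)) (by
      intro σ hσ
      obtain ⟨m, hm, g, y, rfl⟩ := hσ
      obtain _ | n := n
      · omega
      obtain ⟨j, g', rfl⟩ := SimplexCategory.eq_σ_comp_of_not_injective g fun H => by
        have := Fintype.card_le_of_injective _ H
        simp at this
        omega
      by_cases hj : (j : ℕ) + 1 ≤ p
      · rw [mk_eq_zero, TensorProduct.zero_tmul]
        rw [front, ← Functor.map_comp_apply, ← op_comp]
        refine map_mem_degenerate _ ⟨j, by omega⟩ ⟨j + 1, by omega⟩ (by simp) ?_ y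
        exact congrArg g'.toOrderHom (σ_eq j _ _ rfl rfl)
      · rw [mk_eq_zero (σ := back p q h _), TensorProduct.tmul_zero]
        rw [back, ← Functor.map_comp_apply, ← op_comp]
        have := j.2
        refine map_mem_degenerate _ ⟨j - p, by omega⟩ ⟨j - p + 1, by omega⟩ (by simp) ?_ y
        exact congrArg g'.toOrderHom (σ_eq j _ _ (show (j - p + p : ℕ) = j by omega)
          (show (j - p + 1 + p : ℕ) = j + 1 by omega)))
  else 0

lemma Δ_mk (p q n : ℕ) (h : p + q = n) (σ : S _⦋n⦌) :
    Δ k S p q n (mk k σ) = mk k (front p (by omega) σ) ⊗ₜ mk k (back p q h σ) := by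
  simp [Δ, h]

lemma d_d (n : ℕ) (x : NormChains k S (n + 2)) : d k S n (d k S (n + 1) x) = 0 := by
  suffices H : d k S n ∘ₗ d k S (n + 1) = 0 from LinearMap.congr_fun H x
  refine hom_ext fun σ => ?_
  simp only [LinearMap.comp_apply, d_mk, map_sum, map_smul, Finset.smul_sum, LinearMap.zero_apply,
    smul_smul]
  rw [Finset.sum_comm, ← Finset.sum_product']
  let P := Fin (n + 2) × Fin (n + 3)
  let T : Finset P := Finset.univ.filter fun ij => (ij.2 : ℕ) ≤ (ij.1 : ℕ)
  rw [Finset.univ_product_univ, ← Finset.sum_add_sum_compl T, ← eq_neg_iff_add_eq_zero,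
    ← Finset.sum_neg_distrib]
  let φ : ∀ ij : P, ij ∈ T → P := fun ij hij =>
    (Fin.castLT ij.2 (lt_of_le_of_lt (Finset.mem_filter.mp hij).right (Fin.is_lt ij.1)), ij.1.succ)
  apply Finset.sum_bij φ
  · intro ij hij
    simp_rw [T, φ, Finset.compl_filter, Finset.mem_filter_univ, Fin.val_succ,
      Fin.val_castLT] at hij ⊢
    omega
  · rintro ⟨i, j⟩ hij ⟨i', j'⟩ hij' h
    rw [Prod.mk_inj]
    exact ⟨by simpa [φ] using! congr_arg Prod.snd h,
      by simpa [φ, Fin.castSucc_castLT] using! congr_arg Fin.castSucc (congr_arg Prod.fst h)⟩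
  · rintro ⟨i', j'⟩ hij'
    simp_rw [T, Finset.compl_filter, Finset.mem_filter_univ, not_le] at hij'
    refine ⟨(j'.pred <| ?_, Fin.castSucc i'), ?_, ?_⟩
    · rintro rfl
      simp only [Fin.val_zero, not_lt_zero] at hij'
    · simpa [T] using! Nat.le_sub_one_of_lt hij'
    · simp only [φ, Fin.castLT_castSucc, Fin.succ_pred]
  · rintro ⟨i, j⟩ hij
    have hij' : (j : ℕ) ≤ i := by simpa [T] using hij
    have e : S.δ i (S.δ j σ) = S.δ (j.castLT (by omega)) (S.δ i.succ σ) :=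
      (ConcreteCategory.congr_hom (S.δ_comp_δ'' (i := j) (j := i) hij') σ).symm
    simp only [φ, Fin.val_succ, Fin.val_castLT, e]
    rw [← neg_smul]
    congr 1
    ring

lemma Δ_d (p q : ℕ) (x : NormChains k S (p + q + 1)) :
    Δ k S p q (p + q) (d k S (p + q) x) =
      (d k S p).rTensor _ (Δ k S (p + 1) q (p + q + 1) x) +
        (-1 : k) ^ p • (d k S q).lTensor _ (Δ k S p (q + 1) (p + q + 1) x) := by
  suffices H : Δ k S p q (p + q) ∘ₗ d k S (p + q) =
      (d k S p).rTensor _ ∘ₗ Δ k S (p + 1) q (p + q + 1) +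
        (-1 : k) ^ p • (d k S q).lTensor _ ∘ₗ Δ k S p (q + 1) (p + q + 1) from
    LinearMap.congr_fun H x
  refine hom_ext fun σ => ?_
  simp only [LinearMap.comp_apply, LinearMap.add_apply, LinearMap.smul_apply]
  rw [Δ_mk (p + 1) q _ (by omega), Δ_mk p (q + 1) _ (by omega)]
  simp only [d_mk, map_sum, map_smul, LinearMap.rTensor_tmul, LinearMap.lTensor_tmul,
    TensorProduct.sum_tmul, TensorProduct.tmul_sum, ← TensorProduct.smul_tmul',
    TensorProduct.tmul_smul]
  simp only [Δ_mk p q (p + q) rfl]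
  rw [← (finCongr (show p + 1 + (q + 1) = p + q + 2 by omega)).sum_comp, Fin.sum_univ_add,
    Fin.sum_univ_castSucc (n := p + 1), Fin.sum_univ_succ (n := q + 1)]
  have v : ∀ {n : ℕ} (i : Fin (n + 2)) (a : Fin (n + 1)),
      ((SimplexCategory.δ i).toOrderHom a : ℕ) = if (a : ℕ) < i then (a : ℕ) else a + 1 := by
    intro n i a
    change ((i.succAbove a : Fin _) : ℕ) = _
    simp only [Fin.succAbove, Fin.lt_def]
    split_ifs <;> simp_all
  have w : ∀ {n : ℕ} (j l : ℕ) (h : j + l ≤ n) (a : Fin (l + 1)),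
      ((SimplexCategory.subinterval j l h).toOrderHom a : ℕ) = a + j := fun _ _ _ _ => rfl
  have e1 : ∀ i : Fin (p + 1), front p (Nat.le_add_right p q)
      (S.δ (Fin.cast (by omega) (Fin.castAdd (q + 1) i)) σ) =
      S.δ i.castSucc (front (p + 1) (by omega) σ) := fun i =>
    map_map_eq _ _ _ _ (fun a => by
      rw [v, w, w, v]; simp) σ
  have e2 : ∀ i : Fin (p + 1), back p q rfl
      (S.δ (Fin.cast (by omega) (Fin.castAdd (q + 1) i)) σ) =
      back (p + 1) q (by omega) σ := fun i =>
    map_map_eq' _ _ _ (fun a => by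
      rw [v, w, w, if_neg (by simp; omega)]; omega) σ
  have e3 : ∀ j : Fin (q + 1), front p (Nat.le_add_right p q)
      (S.δ (Fin.cast (by omega) (Fin.natAdd (p + 1) j)) σ) = front p (by omega) σ := fun j =>
    map_map_eq' _ _ _ (fun a => by
      rw [v, w, w, if_pos (by simp; omega)]) σ
  have e4 : ∀ j : Fin (q + 1), back p q rfl
      (S.δ (Fin.cast (by omega) (Fin.natAdd (p + 1) j)) σ) =
      S.δ j.succ (back p (q + 1) (by omega) σ) := fun j =>
    map_map_eq _ _ _ _ (fun a => by
      rw [v, w, w, v]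
      simp only [Fin.val_cast, Fin.val_natAdd, Fin.val_succ]
      split_ifs <;> omega) σ
  have e5 : S.δ (Fin.last (p + 1)) (front (p + 1) (by omega) σ) = front p (by omega) σ :=
    map_map_eq' _ _ _ (fun a => by
      
      have h : (a : ℕ) < (Fin.last (p + 1) : Fin (p + 2)) := a.2
      rw [w, v, w, if_pos h]) σ
  have e6 : S.δ 0 (back p (q + 1) (by omega) σ) = back (p + 1) q (by omega) σ :=
    map_map_eq' _ _ _ (fun a => by
      rw [w, w, v, if_neg (by simp)]; omega) σ
  simp only [finCongr_apply, e1, e2, e3, e4, e5, e6, Fin.val_cast, Fin.val_castAdd,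
    Fin.val_natAdd, Fin.val_castSucc, Fin.val_succ, Fin.val_last, Fin.val_zero, pow_zero,
    one_smul, smul_add, Finset.smul_sum, smul_smul]
  have e7 : ∀ (j : ℕ), (-1 : k) ^ (p + 1 + j) = (-1) ^ p * (-1) ^ (j + 1) := fun j => by ring
  simp only [e7]
  have key : ∀ {M : Type (max u v)} [AddCommGroup M] (a b s t : M), s + t = 0 →
      a + b = a + s + (t + b) := fun a b s t h => by
    rw [add_assoc, ← add_assoc s, h, zero_add]
  refine key _ _ _ _ ?_
  rw [← add_smul, pow_succ]
  simp

lemma coassoc (a b c : ℕ) (x : NormChains k S (a + b + c)) :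
    TensorProduct.assoc k _ _ _
      ((Δ k S a b (a + b)).rTensor _ (Δ k S (a + b) c (a + b + c) x)) =
      (Δ k S b c (b + c)).lTensor _ (Δ k S a (b + c) (a + b + c) x) := by
  suffices H : (TensorProduct.assoc k _ _ _).toLinearMap ∘ₗ
      (Δ k S a b (a + b)).rTensor _ ∘ₗ Δ k S (a + b) c (a + b + c) =
      (Δ k S b c (b + c)).lTensor _ ∘ₗ Δ k S a (b + c) (a + b + c) from LinearMap.congr_fun H x
  refine hom_ext fun σ => ?_
  simp only [LinearMap.comp_apply]
  rw [Δ_mk (a + b) c _ rfl, Δ_mk a (b + c) _ (by omega)]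
  simp only [LinearMap.rTensor_tmul, LinearMap.lTensor_tmul, Δ_mk a b _ rfl, Δ_mk b c _ rfl,
    LinearEquiv.coe_coe, TensorProduct.assoc_tmul]
  have w : ∀ {n : ℕ} (j l : ℕ) (h : j + l ≤ n) (a : Fin (l + 1)),
      ((SimplexCategory.subinterval j l h).toOrderHom a : ℕ) = a + j := fun _ _ _ _ => rfl
  have e1 : front a (Nat.le_add_right a b) (front (a + b) (Nat.le_add_right _ c) σ) =
      front a (by omega) σ :=
    map_map_eq' _ _ _ (fun i => by simp only [w]) σ
  have e2 : back a b rfl (front (a + b) (Nat.le_add_right _ c) σ) =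
      front b (Nat.le_add_right b c) (back a (b + c) (by omega) σ) :=
    map_map_eq _ _ _ _ (fun i => by simp only [w]; omega) σ
  have e3 : back b c rfl (back a (b + c) (by omega) σ) = back (a + b) c rfl σ :=
    map_map_eq' _ _ _ (fun i => by simp only [w]; omega) σ
  rw [e1, e2, e3]

/-- The augmentation, an isomorphism for a simplicial set with one vertex. -/
noncomputable def counit [Unique (S _⦋0⦌)] : NormChains k S 0 ≃ₗ[k] k :=
  LinearEquiv.ofLinearMap (lift (fun _ => 1) (by simp)) (LinearMap.toSpanSingleton k _ (mk k default))
    (by ext; simp) (hom_ext fun σ => by simp [Subsingleton.elim σ default])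

@[simp] lemma counit_mk [Unique (S _⦋0⦌)] (σ : S _⦋0⦌) : counit (mk k σ) = 1 :=
  lift_mk _ (by simp) σ

lemma counit_d [Unique (S _⦋0⦌)] (x : NormChains k S 1) : counit (d k S 0 x) = 0 := by
  suffices H : counit.toLinearMap ∘ₗ d k S 0 = 0 from LinearMap.congr_fun H x
  exact hom_ext fun σ => by simp [Fin.sum_univ_two]

lemma counit_left [Unique (S _⦋0⦌)] (n : ℕ) (x : NormChains k S n) :
    TensorProduct.lid k _ ((counit (k := k) (S := S)).toLinearMap.rTensor _ (Δ k S 0 n n x)) = x := by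
  suffices H : (TensorProduct.lid k _).toLinearMap ∘ₗ
      (counit (k := k) (S := S)).toLinearMap.rTensor _ ∘ₗ Δ k S 0 n n = LinearMap.id from
    LinearMap.congr_fun H x
  refine hom_ext fun σ => ?_
  have e : back 0 n (zero_add n) σ = σ := S.map_id_apply _ σ
  simp [Δ_mk 0 n n (zero_add n), e]

lemma counit_right [Unique (S _⦋0⦌)] (n : ℕ) (x : NormChains k S n) :
    TensorProduct.rid k _ ((counit (k := k) (S := S)).toLinearMap.lTensor _ (Δ k S n 0 n x)) = x := by
  suffices H : (TensorProduct.rid k _).toLinearMap ∘ₗ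
      (counit (k := k) (S := S)).toLinearMap.lTensor _ ∘ₗ Δ k S n 0 n = LinearMap.id from
    LinearMap.congr_fun H x
  refine hom_ext fun σ => ?_
  have e : front n le_rfl σ = σ := S.map_id_apply _ σ
  simp [Δ_mk n 0 n (add_zero n), e]

/-- The chain map induced by a simplicial map. -/
noncomputable def map {T : SSet.{u}} (f : S ⟶ T) (n : ℕ) : NormChains k S n →ₗ[k] NormChains k T n :=
  lift (fun σ => mk k (f.app (op ⦋n⦌) σ)) (by
    rintro _ ⟨m, hm, g, y, rfl⟩
    refine mk_eq_zero ⟨m, hm, g, f.app _ y, ?_⟩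
    exact (NatTrans.naturality_apply f g.op y).symm)

@[simp] lemma map_mk {T : SSet.{u}} (f : S ⟶ T) (n : ℕ) (σ : S _⦋n⦌) :
    map f n (mk k σ) = mk k (f.app (op ⦋n⦌) σ) := by
  simp [map]

end NormChains

/-- The connected dg coalgebra of normalized chains of a simplicial set with a single vertex. -/
noncomputable def normChains (k : Type v) [CommRing k] (S : SSet.{u}) [Unique (S _⦋0⦌)] :
    ConnDGCoalg.{v, max u v} k where
  C := NormChains k S
  d := NormChains.d k S
  Δ := NormChains.Δ k S
  counit := NormChains.counit
  d_d := NormChains.d_d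
  Δ_eq_zero _ _ _ h := dif_neg h
  coassoc a b c x := NormChains.coassoc a b c x
  Δ_d p q x := NormChains.Δ_d p q x
  counit_d x := NormChains.counit_d x
  counit_left n x := NormChains.counit_left n x
  counit_right n x := NormChains.counit_right n x

/-- Functoriality of normalized chains. -/
noncomputable def normChainsMap (k : Type v) [CommRing k] {S T : SSet.{u}} [Unique (S _⦋0⦌)]
    [Unique (T _⦋0⦌)] (f : S ⟶ T) : (normChains k S).Hom (normChains k T) where
  f := NormChains.map f
  f_d n x := by
    change NormChains.map f n (NormChains.d k S n x) = NormChains.d k T n (NormChains.map f (n + 1) x)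
    suffices H : NormChains.map f n ∘ₗ NormChains.d k S n =
        NormChains.d k T n ∘ₗ NormChains.map f (n + 1) from LinearMap.congr_fun H x
    refine NormChains.hom_ext fun σ => ?_
    simp only [LinearMap.comp_apply, NormChains.d_mk, NormChains.map_mk, map_sum, map_smul]
    refine Finset.sum_congr rfl fun i _ => ?_
    congr 2
    exact NatTrans.naturality_apply f (SimplexCategory.δ i).op σ
  f_Δ p q n x := by
    change TensorProduct.map (NormChains.map f p) (NormChains.map f q) (NormChains.Δ k S p q n x) =
      NormChains.Δ k T p q n (NormChains.map f n x)
    by_cases h : p + q = n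
    · suffices H : TensorProduct.map (NormChains.map f p) (NormChains.map f q) ∘ₗ
          NormChains.Δ k S p q n = NormChains.Δ k T p q n ∘ₗ NormChains.map f n from
        LinearMap.congr_fun H x
      refine NormChains.hom_ext fun σ => ?_
      simp only [LinearMap.comp_apply, NormChains.map_mk, NormChains.Δ_mk p q n h,
        TensorProduct.map_tmul]
      congr 2
      · exact NatTrans.naturality_apply f _ σ
      · exact NatTrans.naturality_apply f _ σ
    · have e : NormChains.Δ k S p q n = 0 := dif_neg h
      have e' : NormChains.Δ k T p q n = 0 := dif_neg h
      rw [e, e']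
      exact map_zero _
  f_counit x := by
    change NormChains.counit (NormChains.map f 0 x) = NormChains.counit x
    suffices H : (NormChains.counit (k := k) (S := T)).toLinearMap ∘ₗ NormChains.map f 0 =
        NormChains.counit.toLinearMap from LinearMap.congr_fun H x
    exact NormChains.hom_ext fun σ => by simp

end Chains

/-! ### The bialgebra structure on the zeroth homology of the cobar construction -/

namespace ConnDGCoalg
variable {k : Type v} [CommRing k] {A : ConnDGCoalg.{v, w} k}

lemma algHom_cobarD {B : Type*} [Ring B] [Algebra k B] (φ : A.CobarAlg →ₐ[k] B)
    (h : ∀ n x, φ (A.genD n x) = 0) (a : A.CobarAlg) : φ (A.cobarD a) = 0 := by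
  induction a using A.cobar_induction with
  | h0 r => simp
  | h1 n x => rw [cobarD_gen, h]
  | hm a b h h' => simp [cobarD_mul, h, h']
  | ha a b h h' => simp [h, h']

/-- The algebra map out of `H₀(ΩA)` induced by an algebra map which kills the boundaries. -/
noncomputable def liftH0 {B : Type*} [Ring B] [Algebra k B] (φ : A.CobarAlg →ₐ[k] B)
    (h : ∀ n x, φ (A.genD n x) = 0) : A.cobar.H0 →ₐ[k] B :=
  Ideal.Quotient.liftₐ A.cobar.boundaryIdeal
    (φ.comp (SetLike.GradeZero.subalgebra A.cobar.deg).val) (by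
      rintro ⟨_, _⟩ ⟨c, _, rfl⟩
      exact algHom_cobarD φ h c)

/-- The class in `H₀(ΩA)` of an element of degree zero. -/
noncomputable def mkH0 (a : A.CobarAlg) (h : a ∈ A.cobarDeg 0) : A.cobar.H0 := A.cobar.mk0 a h

lemma mkH0_add {a b : A.CobarAlg} (h : a ∈ A.cobarDeg 0) (h' : b ∈ A.cobarDeg 0)
    (h'' : a + b ∈ A.cobarDeg 0) : mkH0 (a + b) h'' = mkH0 a h + mkH0 b h' :=
  A.cobar.mk0_add h h' h''

lemma mkH0_sub {a b : A.CobarAlg} (h : a ∈ A.cobarDeg 0) (h' : b ∈ A.cobarDeg 0)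
    (h'' : a - b ∈ A.cobarDeg 0) : mkH0 (a - b) h'' = mkH0 a h - mkH0 b h' :=
  A.cobar.mk0_sub h h' h''

lemma mkH0_mul {a b : A.CobarAlg} (h : a ∈ A.cobarDeg 0) (h' : b ∈ A.cobarDeg 0)
    (h'' : a * b ∈ A.cobarDeg 0) : mkH0 (a * b) h'' = mkH0 a h * mkH0 b h' :=
  A.cobar.mk0_mul h h' h''

lemma mkH0_smul {a : A.CobarAlg} (r : k) (h : a ∈ A.cobarDeg 0) (h' : r • a ∈ A.cobarDeg 0) :
    mkH0 (r • a) h' = r • mkH0 a h :=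
  A.cobar.mk0_smul r h h'

lemma mkH0_zero : mkH0 (0 : A.CobarAlg) (zero_mem _) = 0 := rfl

lemma mkH0_one : mkH0 (1 : A.CobarAlg) one_mem_cobarDeg = 1 := rfl

lemma mkH0_eq_zero {a c : A.CobarAlg} (h : a ∈ A.cobarDeg 0) (hc : c ∈ A.cobarDeg 1)
    (e : A.cobarD c = a) : mkH0 a h = 0 :=
  A.cobar.mk0_eq_zero h hc e

/-- The class in `H₀(ΩA)` of the generator `s⁻¹x`, for `x` of degree one. -/
noncomputable def classH0 : A.C 1 →ₗ[k] A.cobar.H0 where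
  toFun x := mkH0 (A.gen 0 x) (gen_mem 0 x)
  map_add' x y := by simp only [map_add]; exact mkH0_add _ _ _
  map_smul' r x := by simp only [map_smul]; exact mkH0_smul _ _ _

@[simp] lemma liftH0_class {B : Type*} [Ring B] [Algebra k B] (φ : A.CobarAlg →ₐ[k] B)
    (h : ∀ n x, φ (A.genD n x) = 0) (x : A.C 1) : liftH0 φ h (classH0 x) = φ (A.gen 0 x) := rfl

lemma H0_hom_ext {B : Type*} [Ring B] [Algebra k B] {f g : A.cobar.H0 →ₐ[k] B}
    (h : ∀ x : A.C 1, f (classH0 x) = g (classH0 x)) : f = g := by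
  suffices H : ∀ n a, a ∈ A.cobarDeg n → n = 0 → ∀ ha, f (mkH0 a ha) = g (mkH0 a ha) by
    ext a
    obtain ⟨⟨a, ha⟩, rfl⟩ := Ideal.Quotient.mk_surjective a
    exact H 0 a ha rfl ha
  intro n a ha
  induction ha using cobarDeg_induction with
  | h0 n => intro _ _; rw [mkH0_zero, map_zero, map_zero]
  | h1 => intro _ _; rw [mkH0_one, map_one, map_one]
  | hg m n x a ha ih =>
    intro hn _
    obtain rfl : m = 0 := by omega
    obtain rfl : n = 0 := by omega
    rw [mkH0_mul (gen_mem 0 x) ha _, map_mul, map_mul, ih rfl ha]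
    exact congrArg (· * _) (h x)
  | ha n a b ha hb h h' =>
    intro hn _
    subst hn
    rw [mkH0_add ha hb _, map_add, map_add, h rfl, h' rfl]
  | hs n r a ha h =>
    intro hn _
    subst hn
    rw [mkH0_smul r ha _, map_smul, map_smul, h rfl]

lemma genD_one (c : A.C 2) :
    A.genD 1 c = -A.gen 0 (A.d 1 c) - A.gen₂ 0 0 (A.Δ 1 1 2 c) := by
  simp [genD, sub_eq_add_neg]

lemma classH0_map {B : ConnDGCoalg.{v, w'} k} (φ : A.Hom B) (x : A.C 1) :
    φ.cobar.H0Map (classH0 x) = classH0 (φ.f 1 x) := by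
  have : φ.cobarAlgHom (A.gen 0 x) = B.gen 0 (φ.f 1 x) := by simp
  exact congrArg (Ideal.Quotient.mk B.cobar.boundaryIdeal) (Subtype.ext this)

end ConnDGCoalg

section Bialgebra

open Simplicial

variable (k : Type v) [CommRing k] (S : SSet.{u}) [Unique (S _⦋0⦌)]

/-- The zeroth homology of the cobar construction on the normalized chains of `S`. -/
abbrev CobarH0 : Type (max u v) := (normChains k S).cobar.H0

namespace CobarH0

variable {S}

/-- The chain given by a simplex. -/
noncomputable def chain {n : ℕ} (σ : S _⦋n⦌) : (normChains k S).C n := NormChains.mk k σ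

/-- The class `[σ]` of a `1`-simplex. -/
noncomputable def bar (σ : S _⦋1⦌) : CobarH0 k S :=
  (normChains k S).classH0 (chain k σ)

lemma bar_degenerate {σ : S _⦋1⦌} (h : σ ∈ S.degenerate 1) : bar k σ = 0 := by
  rw [bar, chain, NormChains.mk_eq_zero h]
  exact map_zero (normChains k S).classH0

variable {k}

lemma algHom_ext {B : Type*} [Ring B] [Algebra k B] {f g : CobarH0 k S →ₐ[k] B}
    (h : ∀ σ, f (bar k σ) = g (bar k σ)) : f = g := by
  refine ConnDGCoalg.H0_hom_ext fun x => ?_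
  have H : f.toLinearMap ∘ₗ (normChains k S).classH0 =
      g.toLinearMap ∘ₗ (normChains k S).classH0 := NormChains.hom_ext h
  exact LinearMap.congr_fun H x

/-- The algebra map with prescribed values on generators `s⁻¹σ` of degree zero, and zero on
generators of positive degree. -/
noncomputable def preLift {B : Type*} [Ring B] [Algebra k B] (g : S _⦋1⦌ → B)
    (hg : ∀ σ ∈ S.degenerate 1, g σ = 0) : (normChains k S).CobarAlg →ₐ[k] B :=
  ConnDGCoalg.lift fun n => match n with
    | .zero => NormChains.lift g hg
    | .succ _ => 0

lemma genD_chain (τ : S _⦋2⦌) : (normChains k S).genD 1 (chain k τ) =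
    -((normChains k S).gen 0 (chain k (S.δ 0 τ)) - (normChains k S).gen 0 (chain k (S.δ 1 τ)) +
      (normChains k S).gen 0 (chain k (S.δ 2 τ))) -
    (normChains k S).gen 0 (chain k (S.δ 2 τ)) * (normChains k S).gen 0 (chain k (S.δ 0 τ)) := by
  have e1 : (normChains k S).d 1 (chain k τ) =
      chain k (S.δ 0 τ) - chain k (S.δ 1 τ) + chain k (S.δ 2 τ) := by
    refine (NormChains.d_mk 1 τ).trans ?_
    have e : ∀ a b c : NormChains k S 1, ((-1 : k) ^ 0 • a + (-1 : k) ^ 1 • b) + (-1 : k) ^ 2 • c =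
        a - b + c := fun a b c => by simp [sub_eq_add_neg]
    rw [Fin.sum_univ_three]
    exact e _ _ _
  have e2 : (normChains k S).Δ 1 1 2 (chain k τ) = chain k (S.δ 2 τ) ⊗ₜ chain k (S.δ 0 τ) := by
    refine (NormChains.Δ_mk 1 1 2 rfl τ).trans ?_
    have f1 : SimplexCategory.subinterval 0 1 (by omega : 0 + 1 ≤ 2) = SimplexCategory.δ 2 := by
      ext i : 3
      fin_cases i <;> rfl
    have f2 : SimplexCategory.subinterval 1 1 (by omega : 1 + 1 ≤ 2) = SimplexCategory.δ 0 := by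
      ext i : 3
      fin_cases i <;> rfl
    rw [NormChains.front, NormChains.back, f1, f2]
    rfl
  rw [ConnDGCoalg.genD_one, e1, e2, map_add, map_sub, ConnDGCoalg.gen₂_tmul]

/-- An algebra map out of `H₀` is determined by the values on the classes `[σ]`, which have to be
compatible with degenerate simplices and with `2`-simplices. -/
noncomputable def lift {B : Type*} [Ring B] [Algebra k B] (g : S _⦋1⦌ → B)
    (hg : ∀ σ ∈ S.degenerate 1, g σ = 0)
    (hτ : ∀ τ : S _⦋2⦌, 1 + g (S.δ 1 τ) = (1 + g (S.δ 2 τ)) * (1 + g (S.δ 0 τ))) :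
    CobarH0 k S →ₐ[k] B :=
  ConnDGCoalg.liftH0 (preLift g hg) (by
    have h0 : ∀ x, preLift g hg ((normChains k S).gen 0 x) = NormChains.lift g hg x :=
      fun x => ConnDGCoalg.lift_gen _ 0 x
    have h1 : ∀ n x, preLift g hg ((normChains k S).gen (n + 1) x) = 0 :=
      fun n x => ConnDGCoalg.lift_gen _ (n + 1) x
    have h2 : ∀ p q, p + q ≠ 0 → ∀ t, preLift g hg ((normChains k S).gen₂ p q t) = 0 := by
      intro p q hpq t
      induction t with
      | zero => simp
      | tmul x y =>
        rw [ConnDGCoalg.gen₂_tmul, map_mul]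
        cases p with
        | succ p => rw [h1, zero_mul]
        | zero =>
          cases q with
          | succ q => rw [h1, mul_zero]
          | zero => exact absurd rfl hpq
      | add x y h h' => rw [map_add, map_add, h, h', add_zero]
    intro n x
    obtain _ | _ | n := n
    · exact map_zero _
    · suffices H : (preLift g hg).toLinearMap ∘ₗ (normChains k S).genD 1 = 0 from
        LinearMap.congr_fun H x
      refine NormChains.hom_ext fun τ => ?_
      have h0' : ∀ σ : S _⦋1⦌, preLift g hg ((normChains k S).gen 0 (chain k σ)) = g σ :=
        fun σ => (h0 _).trans (NormChains.lift_mk g hg σ)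
      change preLift g hg ((normChains k S).genD 1 (chain k τ)) = 0
      rw [genD_chain, map_sub, map_neg, map_add, map_sub, map_mul, h0', h0', h0']
      have e : g (S.δ 1 τ) = g (S.δ 0 τ) + g (S.δ 2 τ) + g (S.δ 2 τ) * g (S.δ 0 τ) := by
        have e := hτ τ
        rw [mul_add, mul_one, add_mul, one_mul] at e
        rw [eq_sub_of_add_eq' e]
        abel
      rw [e]
      abel
    · simp only [ConnDGCoalg.genD, LinearMap.add_apply, LinearMap.neg_apply, LinearMap.comp_apply,
        LinearMap.sum_apply, LinearMap.smul_apply, map_add, map_neg, map_sum, map_smul, h1,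
        neg_zero, zero_add]
      refine Finset.sum_eq_zero fun pq h => ?_
      rw [Finset.HasAntidiagonal.mem_antidiagonal] at h
      rw [h2 _ _ (by omega), smul_zero])

@[simp] lemma lift_bar {B : Type*} [Ring B] [Algebra k B] (g : S _⦋1⦌ → B)
    (hg : ∀ σ ∈ S.degenerate 1, g σ = 0)
    (hτ : ∀ τ : S _⦋2⦌, 1 + g (S.δ 1 τ) = (1 + g (S.δ 2 τ)) * (1 + g (S.δ 0 τ))) (σ : S _⦋1⦌) :
    lift g hg hτ (bar k σ) = g σ :=
  (ConnDGCoalg.lift_gen _ 0 _).trans (NormChains.lift_mk g hg σ)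

/-- The relation in `H₀` given by a `2`-simplex. -/
lemma one_add_bar (τ : S _⦋2⦌) :
    1 + bar k (S.δ 1 τ) = (1 + bar k (S.δ 2 τ)) * (1 + bar k (S.δ 0 τ)) := by
  have h0 := ConnDGCoalg.gen_mem 0 (chain k (S.δ 0 τ))
  have h1 := ConnDGCoalg.gen_mem 0 (chain k (S.δ 1 τ))
  have h2 := ConnDGCoalg.gen_mem 0 (chain k (S.δ 2 τ))
  have h3 := ConnDGCoalg.mul_mem_cobarDeg h2 h0
  have h4 := add_mem h0 h2
  have h5 := sub_mem h1 h4
  have key := ConnDGCoalg.mkH0_eq_zero (sub_mem h5 h3) (ConnDGCoalg.gen_mem 1 (chain k τ)) (by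
    rw [ConnDGCoalg.cobarD_gen, genD_chain]
    abel)
  rw [ConnDGCoalg.mkH0_sub h5 h3, ConnDGCoalg.mkH0_sub h1 h4, ConnDGCoalg.mkH0_add h0 h2,
    ConnDGCoalg.mkH0_mul h2 h0] at key
  have h : bar k (S.δ 1 τ) = bar k (S.δ 0 τ) + bar k (S.δ 2 τ) +
      bar k (S.δ 2 τ) * bar k (S.δ 0 τ) := by
    rw [← sub_eq_zero, ← sub_sub]
    exact key
  rw [h, mul_add, mul_one, add_mul, one_mul]
  abel

variable (k S)

/-- The coproduct, `∇[σ] = [σ] ⊗ [σ] + [σ] ⊗ 1 + 1 ⊗ [σ]`. -/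
noncomputable def comul : CobarH0 k S →ₐ[k] CobarH0 k S ⊗[k] CobarH0 k S :=
  lift (fun σ => bar k σ ⊗ₜ bar k σ + bar k σ ⊗ₜ 1 + 1 ⊗ₜ bar k σ)
    (fun σ h => by simp [bar_degenerate k h])
    (fun τ => by
      have h : ∀ x : CobarH0 k S, 1 + (x ⊗ₜ[k] x + x ⊗ₜ[k] 1 + 1 ⊗ₜ[k] x) =
          (1 + x) ⊗ₜ[k] (1 + x) := fun x => by
        rw [Algebra.TensorProduct.one_def, TensorProduct.add_tmul, TensorProduct.tmul_add,
          TensorProduct.tmul_add]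
        abel
      rw [h, h, h, Algebra.TensorProduct.tmul_mul_tmul, one_add_bar])

/-- The counit, `ε[σ] = 0`. -/
noncomputable def counit : CobarH0 k S →ₐ[k] k :=
  lift (fun _ => 0) (fun _ _ => rfl) (fun _ => by simp)

@[simp] lemma comul_bar (σ : S _⦋1⦌) :
    comul k S (bar k σ) = bar k σ ⊗ₜ bar k σ + bar k σ ⊗ₜ 1 + 1 ⊗ₜ bar k σ := lift_bar _ _ _ σ

@[simp] lemma counit_bar (σ : S _⦋1⦌) : counit k S (bar k σ) = 0 := lift_bar _ _ _ σ

/-- The bialgebra structure on `H₀(Ω C_*(S))`. -/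
noncomputable instance : Bialgebra k (CobarH0 k S) :=
  Bialgebra.ofAlgHom (comul k S) (counit k S)
    (algHom_ext fun σ => by
      simp [TensorProduct.add_tmul, TensorProduct.tmul_add, Algebra.TensorProduct.one_def]
      abel)
    (algHom_ext fun σ => by simp)
    (algHom_ext fun σ => by simp)

variable {S}

lemma H0Map_bar {T : SSet.{u}} [Unique (T _⦋0⦌)] (f : S ⟶ T) (σ : S _⦋1⦌) :
    (normChainsMap k f).cobar.H0Map (bar k σ) = bar k (f.app _ σ) := by
  refine (ConnDGCoalg.classH0_map _ _).trans ?_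
  exact congrArg (normChains k T).classH0 (NormChains.map_mk f 1 σ)

/-- The bialgebra map on `H₀(Ω C_*)` induced by a simplicial map. -/
noncomputable def map {T : SSet.{u}} [Unique (T _⦋0⦌)] (f : S ⟶ T) :
    CobarH0 k S →ₐc[k] CobarH0 k T :=
  BialgHom.ofAlgHom (normChainsMap k f).cobar.H0Map
    (algHom_ext fun σ => by
      rw [AlgHom.comp_apply, H0Map_bar]
      exact (counit_bar k T _).trans (counit_bar k S σ).symm)
    (algHom_ext fun σ => by
      rw [AlgHom.comp_apply, AlgHom.comp_apply, H0Map_bar]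
      refine Eq.trans ?_ (comul_bar k T _).symm
      refine (congrArg _ (comul_bar k S σ)).trans ?_
      simp [H0Map_bar])

@[simp] lemma map_bar {T : SSet.{u}} [Unique (T _⦋0⦌)] (f : S ⟶ T) (σ : S _⦋1⦌) :
    map k f (bar k σ) = bar k (f.app _ σ) := H0Map_bar k f σ

end CobarH0
end Bialgebra

/-! ### Singular simplices with vertices at the base point -/

section Singular

open Simplicial

/-- The simplicial subset `Sing⁰(X, x)` of the singular simplicial set of `X`: the singular simplices
all of whose vertices are at `x`. -/
noncomputable def sing0Sub (X : Type u) [TopologicalSpace X] (x : X) :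
    (TopCat.toSSet.obj (TopCat.of X)).Subcomplex where
  obj n := {σ | ∀ i, TopCat.toSSetObjEquiv (TopCat.of X) n σ (stdSimplex.vertex i) = x}
  map {m n} g σ hσ i := by
    have h := hσ (g.unop.toOrderHom i)
    rw [← stdSimplex.map_vertex] at h
    exact h

/-- `Sing⁰(X, x)`. -/
noncomputable abbrev Sing0 (X : Type u) [TopologicalSpace X] (x : X) : SSet.{u} := (sing0Sub X x).toSSet

variable {X Y : Type u} [TopologicalSpace X] [TopologicalSpace Y]

noncomputable instance (x : X) : Unique (Sing0 X x _⦋0⦌) where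
  default := ⟨(TopCat.toSSetObjEquiv (TopCat.of X) _).symm (ContinuousMap.const _ x), fun i => by simp⟩
  uniq σ := by
    refine Subtype.ext ((TopCat.toSSetObjEquiv (TopCat.of X) _).injective ?_)
    refine ContinuousMap.ext fun z => ?_
    obtain rfl : z = stdSimplex.vertex 0 :=
      @Subsingleton.elim (stdSimplex ℝ (Fin 1)) inferInstance _ _
    rw [σ.2 0]
    simp

/-- The simplicial map `Sing⁰(X, x) → Sing⁰(Y, y)` induced by a pointed continuous map. -/
noncomputable def sing0Map (f : C(X, Y)) {x : X} {y : Y} (hf : f x = y) : Sing0 X x ⟶ Sing0 Y y :=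
  SSet.Subcomplex.lift ((sing0Sub X x).ι ≫ TopCat.toSSet.map (TopCat.ofHom f)) (by
    rintro n _ ⟨σ, rfl⟩ i
    exact (congrArg f (σ.2 i)).trans hf)

/-- A loop at `x`, viewed as a `1`-simplex of `Sing⁰(X, x)`; the first vertex of the `1`-simplex
corresponds to the start of the loop. -/
noncomputable def loopSimplex {x : X} (γ : Path x x) : Sing0 X x _⦋1⦌ :=
  ⟨(TopCat.toSSetObjEquiv (TopCat.of X) _).symm
    (γ.toContinuousMap.comp (stdSimplexHomeomorphUnitInterval : C(stdSimplex ℝ (Fin 2), unitInterval))), by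
    intro i
    rw [Equiv.apply_symm_apply]
    have h : ∀ i : Fin 2, γ (stdSimplexHomeomorphUnitInterval (stdSimplex.vertex i)) = x := by
      intro i
      fin_cases i
      · exact (congrArg γ stdSimplexHomeomorphUnitInterval_zero).trans γ.source
      · exact (congrArg γ stdSimplexHomeomorphUnitInterval_one).trans γ.target
    exact h i⟩

variable (k : Type v) [CommRing k]

/-- The connected dg coalgebra `C⁰_*(X, x)` of normalized singular chains with vertices at `x`. -/
noncomputable abbrev singChains (X : Type u) [TopologicalSpace X] (x : X) :
    ConnDGCoalg.{v, max u v} k :=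
  normChains k (Sing0 X x)

/-- The map `C⁰_*(X, x) → C⁰_*(Y, y)` induced by a pointed continuous map. -/
noncomputable abbrev singChainsMap (f : C(X, Y)) {x : X} {y : Y} (hf : f x = y) :
    (singChains k X x).Hom (singChains k Y y) :=
  normChainsMap k (sing0Map f hf)

/-- The bialgebra `H₀(Ω C⁰_*(X, x))`. -/
abbrev SingH0 (X : Type u) [TopologicalSpace X] (x : X) : Type (max u v) := CobarH0 k (Sing0 X x)

/-- The map `H₀(Ω C⁰_*(f))`. -/
noncomputable abbrev singH0Map (f : C(X, Y)) {x : X} {y : Y} (hf : f x = y) :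
    SingH0 k X x →ₐc[k] SingH0 k Y y :=
  CobarH0.map k (sing0Map f hf)

/-- The fundamental group, with product `[γ] * [δ]` the class of "first `γ`, then `δ`"; this is the
opposite of the convention for `FundamentalGroup`. -/
abbrev PiOne (X : Type u) [TopologicalSpace X] (x : X) : Type u := (FundamentalGroup X x)ᵐᵒᵖ

/-- The class of a loop in the fundamental group. -/
def loopClass {x : X} (γ : Path x x) : PiOne X x :=
  MulOpposite.op (FundamentalGroup.fromPath (Path.Homotopic.Quotient.mk γ))

lemma loopClass_trans {x : X} (γ δ : Path x x) :
    loopClass (γ.trans δ) = loopClass γ * loopClass δ := rfl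

/-- The map induced on fundamental groups by a pointed continuous map. -/
noncomputable def piOneMap (f : C(X, Y)) {x : X} {y : Y} (hf : f x = y) : PiOne X x →* PiOne Y y :=
  MonoidHom.op (FundamentalGroup.mapOfEq f hf)

end Singular

/-- A bialgebra is a Hopf algebra if it admits an antipode. -/
def HasAntipode (k : Type*) (H : Type*) [CommRing k] [Ring H] [Bialgebra k H] : Prop :=
  ∃ s : H →ₗ[k] H,
    LinearMap.mul' k H ∘ₗ s.rTensor H ∘ₗ Coalgebra.comul =
      Algebra.linearMap k H ∘ₗ Coalgebra.counit ∧
    LinearMap.mul' k H ∘ₗ s.lTensor H ∘ₗ Coalgebra.comul =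
      Algebra.linearMap k H ∘ₗ Coalgebra.counit

/-- Functoriality of the group-like elements. -/
def groupLikeMap {k H H' : Type*} [CommRing k] [Ring H] [Bialgebra k H] [Ring H'] [Bialgebra k H']
    (φ : H →ₐc[k] H') : GroupLike k H →* GroupLike k H' where
  toFun g := ⟨φ g.val, g.isGroupLikeElem_val.map φ⟩
  map_one' := GroupLike.val_injective (map_one φ)
  map_mul' a b := GroupLike.val_injective (map_mul φ a.val b.val)

/-! The algebra `H₀(Ω C⁰_*(X))` has a presentation. Its generators are the classes `[σ]` of the
1-simplices of `Sing⁰(X, x)`, that is, of loops at `x`. Degenerate loops have class zero, and the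
cobar differential of a 2-simplex `τ` gives the relation `1 + [d₁τ] = (1 + [d₂τ]) (1 + [d₀τ])`. In
terms of `g = 1 + [σ]` this says that the constant loop is the unit and that the edges of every
singular triangle multiply. These are relations of the fundamental group, and they also suffice to
define it, so `[σ] ↦ g_σ - 1` should be an isomorphism `ψ` onto `k[π₁(X)]`.

Both directions come down to triangles. For `H₀ → k[π₁]`, a filled triangle gives a relation in `π₁`
because the standard simplex is simply connected (`loopClass_simplexPath_δ`). For `k[π₁] → H₀`, the
map `g_σ ↦ 1 + [σ]` must be well defined and multiplicative. A homotopy is a square, and its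
diagonal cuts it into two triangles (`bar_eq_of_homotopic`); a concatenation is the long edge of a
triangle that collapses onto the unit interval (`one_add_bar_trans`). The coproduct of `H₀` is the
one that makes every `1 + [σ]` group-like, so `ψ` is a map of bialgebras, and it is natural in `X`
(`equivGroupAlgebra_singH0Map`).

The rest is formal. In degree zero the quasi-isomorphism gives a bijection of `H₀`, so `k[π₁(f)]` is
bijective. Since `k` is nonzero, `π₁(f)` can be read off from the basis and is bijective too
(`bijective_of_mapDomainBialgHom_bijective`). Antipodes are transported along `ψ`. The group-like
elements of `k[G]` are exactly those of `G` when `k` has no nontrivial idempotents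
(`exists_single_eq_of_isGroupLikeElem`). -/

/-! ### Transport of antipodes -/

/-- The antipode is the conjugate `e⁻¹ ∘ S ∘ e`; both identities are those of `H'`, pulled back
through `e`. -/
lemma hasAntipode_of_bialgEquiv {k H H' : Type*} [CommRing k] [Ring H] [Bialgebra k H] [Ring H']
    [HopfAlgebra k H'] (e : H ≃ₐc[k] H') : HasAntipode k H := by
  have hs : ∀ a b : H, e.symm (HopfAlgebra.antipode k (e a)) * b =
      e.symm (HopfAlgebra.antipode k (e a) * e b) := by simp
  have hs' : ∀ a b : H, a * e.symm (HopfAlgebra.antipode k (e b)) =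
      e.symm (e a * HopfAlgebra.antipode k (e b)) := by simp
  have hc : ∀ a : H, e.symm (algebraMap k H' (Coalgebra.counit (R := k) (e a))) =
      algebraMap k H (Coalgebra.counit (R := k) a) := fun a => by
    rw [CoalgHomClass.counit_comp_apply, AlgHomClass.commutes]
  refine ⟨(e.symm : H' →ₗ[k] H) ∘ₗ HopfAlgebra.antipode k ∘ₗ (e : H →ₗ[k] H'),
    LinearMap.ext fun a => ?_, LinearMap.ext fun a => ?_⟩
  -- A decomposition of the coproduct of `a` into a sum of pure tensors is carried by `e` to one for
  -- `e a`, so the identity in `H'` can be compared with the desired one term by term.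
  · have := HopfAlgebra.sum_antipode_mul_eq_algebraMap_counit
      ((Coalgebra.Repr.arbitrary k a).induced e)
    simp only [Coalgebra.Repr.induced] at this
    simp only [LinearMap.comp_apply, Algebra.linearMap_apply]
    rw [← hc, ← this, ← (Coalgebra.Repr.arbitrary k a).eq, map_sum, map_sum, map_sum]
    exact Finset.sum_congr rfl fun i _ => hs _ _
  · have := HopfAlgebra.sum_mul_antipode_eq_algebraMap_counit
      ((Coalgebra.Repr.arbitrary k a).induced e)
    simp only [Coalgebra.Repr.induced] at this
    simp only [LinearMap.comp_apply, Algebra.linearMap_apply]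
    rw [← hc, ← this, ← (Coalgebra.Repr.arbitrary k a).eq, map_sum, map_sum, map_sum]
    exact Finset.sum_congr rfl fun i _ => hs' _ _

/-! ### Group-like elements and maps of monoid algebras -/

namespace MonoidAlgebra
variable {k : Type*} [CommRing k] {G H : Type*}

/-- The coefficient at `g`, as a linear form. -/
noncomputable def coeffAt (k : Type*) [CommRing k] {G : Type*} (g : G) : MonoidAlgebra k G →ₗ[k] k :=
  Finsupp.lapply g ∘ₗ (coeffLinearEquiv k).toLinearMap

lemma coeffAt_apply (g : G) (a : MonoidAlgebra k G) : coeffAt k g a = a.coeff g := rfl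

/-- The coproduct is diagonal on the basis, so the coefficient of `g ⊗ h` vanishes off the diagonal.
-/
lemma coeffAt_comul (g h : G) [Decidable (g = h)] (a : MonoidAlgebra k G) :
    LinearMap.mul' k k (TensorProduct.map (coeffAt k g) (coeffAt k h)
      (Coalgebra.comul (R := k) a)) = if g = h then a.coeff g else 0 := by
  induction a using MonoidAlgebra.induction_linear with
  | zero => simp
  | add a b ha hb => simp only [map_add, ha, hb]; split_ifs <;> simp
  | single l r =>
    simp only [comul_single, CommSemiring.comul_apply, TensorProduct.map_tmul, lsingle_apply,
      LinearMap.mul'_apply, coeffAt_apply, coeff_single]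
    classical
    simp only [Finsupp.single_apply]
    split_ifs <;> simp_all

/-- Over a ring without nontrivial idempotents the group-like elements of a monoid algebra are the
elements of the monoid. -/
lemma exists_single_eq_of_isGroupLikeElem [Nontrivial k]
    (hk : ∀ e : k, IsIdempotentElem e → e = 0 ∨ e = 1) {a : MonoidAlgebra k G}
    (ha : IsGroupLikeElem k a) : ∃ g, single g 1 = a := by
  classical
  -- The coefficient of `g ⊗ h` in the coproduct of `a`, computed in two ways: the coefficients of a
  -- group-like element are pairwise orthogonal idempotents.
  have key : ∀ g h, a.coeff g * a.coeff h = if g = h then a.coeff g else 0 := fun g h => by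
    rw [← coeffAt_comul, ha.comul_eq_tmul_self]
    simp [coeffAt_apply]
  obtain ⟨g, hg⟩ : ∃ g, a.coeff g ≠ 0 := by
    by_contra! H
    exact ha.ne_zero (MonoidAlgebra.ext (Finsupp.ext H))
  have hg1 : a.coeff g = 1 := (hk _ ((key g g).trans (if_pos rfl))).resolve_left hg
  refine ⟨g, MonoidAlgebra.ext (Finsupp.ext fun h => ?_)⟩
  rw [coeff_single, Finsupp.single_apply]
  split_ifs with e
  · rw [← e, hg1]
  -- Orthogonality to the coefficient `1` at `g` kills every other coefficient.
  · simpa [hg1, e] using (key g h).symm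

/-- Only the basis is needed, so idempotents of `k` play no role. Distinct basis elements stay
distinct because `1 ≠ 0`. If `h` is not a value of `f`, the coefficient at `h` vanishes on the whole
image, whereas it is `1` on the basis element `h`. -/
lemma bijective_of_mapDomainBialgHom_bijective [Nontrivial k] [Monoid G] [Monoid H] (f : G →* H)
    (hf : Function.Bijective (mapDomainBialgHom k f)) : Function.Bijective f := by
  constructor
  · intro a b hab
    refine single_left_injective (R := k) one_ne_zero (hf.1 ?_)
    simp [hab]
  · intro h
    by_contra H
    obtain ⟨a, ha⟩ := hf.2 (single h 1)
    have key : ∀ a, coeffAt k h (mapDomainBialgHom k f a) = 0 := fun a => by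
      induction a using MonoidAlgebra.induction_linear with
      | zero => simp
      | add a b ha hb => simp only [map_add, ha, hb, add_zero]
      | single g r =>
        rw [mapDomainBialgHom_single, coeffAt_apply, coeff_single]
        exact Finsupp.single_eq_of_ne fun e => H ⟨g, e.symm⟩
    simpa [ha, coeffAt_apply] using key a

end MonoidAlgebra

/-! ### Passage to `H₀` and to group-like elements -/

lemma DGAlg.Hom.H0Map_bijective {k : Type v} [CommRing k] {A : DGAlg.{v, w} k} {B : DGAlg.{v, w'} k}
    {φ : A.Hom B} (h : φ.IsQuasiIso) : Function.Bijective φ.H0Map := by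
  have e : (φ.H0Map : A.H0 → B.H0) =
      B.homologyZeroEquiv ∘ φ.homologyMap 0 ∘ A.homologyZeroEquiv.symm := by
    ext a
    simp [φ.homologyZeroEquiv_homologyMap]
  rw [e]
  exact B.homologyZeroEquiv.bijective.comp ((h 0).comp A.homologyZeroEquiv.symm.bijective)

/-- The inverse of a bijective bialgebra map is again one, so it preserves group-like elements. -/
lemma groupLikeMap_bijective {k H H' : Type*} [CommRing k] [Ring H] [Bialgebra k H] [Ring H']
    [Bialgebra k H'] {φ : H →ₐc[k] H'} (hφ : Function.Bijective φ) :
    Function.Bijective (groupLikeMap φ) := by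
  let e : H ≃ₐc[k] H' := BialgEquiv.ofBijective φ hφ
  refine ⟨fun a b hab => GroupLike.val_injective (hφ.1 (congrArg GroupLike.val hab)), fun b => ?_⟩
  exact ⟨⟨e.symm b.val, b.isGroupLikeElem_val.map e.symm⟩,
    GroupLike.val_injective (e.apply_symm_apply b.val)⟩

/-! ### Loops as 1-simplices, and triangles in the fundamental group -/

section SingularLoops

open Simplicial

variable {X Y : Type u} [TopologicalSpace X] [TopologicalSpace Y] {x : X}

/-- The continuous map underlying a simplex of `Sing⁰(X, x)`. -/
noncomputable def simplexMap {n : ℕ} (σ : Sing0 X x _⦋n⦌) : C(stdSimplex ℝ (Fin (n + 1)), X) :=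
  TopCat.toSSetObjEquiv (TopCat.of X) (op ⦋n⦌) σ.1

lemma simplexMap_injective {n : ℕ} : Function.Injective (simplexMap (x := x) (n := n)) :=
  fun _ _ h => Subtype.ext ((TopCat.toSSetObjEquiv (TopCat.of X) (op ⦋n⦌)).injective h)

lemma simplexMap_vertex {n : ℕ} (σ : Sing0 X x _⦋n⦌) (i : Fin (n + 1)) :
    simplexMap σ (stdSimplex.vertex i) = x := σ.2 i

lemma simplexMap_δ {n : ℕ} (σ : Sing0 X x _⦋n + 1⦌) (i : Fin (n + 2))
    (z : stdSimplex ℝ (Fin (n + 1))) :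
    simplexMap ((Sing0 X x).δ i σ) z = simplexMap σ (stdSimplex.map i.succAbove z) :=
  TopCat.toSSetObjEquiv_δ_apply (X := TopCat.of X) σ.1 i z

lemma simplexMap_σ {n : ℕ} (σ : Sing0 X x _⦋n⦌) (i : Fin (n + 1))
    (z : stdSimplex ℝ (Fin (n + 2))) :
    simplexMap ((Sing0 X x).σ i σ) z = simplexMap σ (stdSimplex.map i.predAbove z) :=
  TopCat.toSSetObjEquiv_σ_apply (X := TopCat.of X) σ.1 i z

/-- The simplex of `Sing⁰(X, x)` given by a continuous map. -/
noncomputable def mkSimplex {n : ℕ} (g : C(stdSimplex ℝ (Fin (n + 1)), X))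
    (hg : ∀ i, g (stdSimplex.vertex i) = x) : Sing0 X x _⦋n⦌ :=
  ⟨(TopCat.toSSetObjEquiv (TopCat.of X) (op ⦋n⦌)).symm g, fun i => by
    rw [Equiv.apply_symm_apply]
    exact hg i⟩

@[simp] lemma simplexMap_mkSimplex {n : ℕ} (g : C(stdSimplex ℝ (Fin (n + 1)), X))
    (hg : ∀ i, g (stdSimplex.vertex i) = x) : simplexMap (mkSimplex g hg) = g :=
  (TopCat.toSSetObjEquiv (TopCat.of X) (op ⦋n⦌)).apply_symm_apply g

lemma simplexMap_loopSimplex (γ : Path x x) (z : stdSimplex ℝ (Fin 2)) :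
    simplexMap (loopSimplex γ) z = γ (stdSimplexHomeomorphUnitInterval z) :=
  DFunLike.congr_fun ((TopCat.toSSetObjEquiv (TopCat.of X) (op ⦋1⦌)).apply_symm_apply _) z

lemma homeomorphUnitInterval_symm_zero :
    stdSimplexHomeomorphUnitInterval.symm 0 = stdSimplex.vertex (S := ℝ) (0 : Fin 2) := by
  rw [Homeomorph.symm_apply_eq]
  exact stdSimplexHomeomorphUnitInterval_zero.symm

lemma homeomorphUnitInterval_symm_one :
    stdSimplexHomeomorphUnitInterval.symm 1 = stdSimplex.vertex (S := ℝ) (1 : Fin 2) := by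
  rw [Homeomorph.symm_apply_eq]
  exact stdSimplexHomeomorphUnitInterval_one.symm

/-- The loop given by a `1`-simplex. -/
noncomputable def simplexPath (σ : Sing0 X x _⦋1⦌) : Path x x where
  toContinuousMap := (simplexMap σ).comp
    (stdSimplexHomeomorphUnitInterval.symm : C(unitInterval, stdSimplex ℝ (Fin 2)))
  source' := (congrArg (simplexMap σ) homeomorphUnitInterval_symm_zero).trans (simplexMap_vertex σ 0)
  target' := (congrArg (simplexMap σ) homeomorphUnitInterval_symm_one).trans (simplexMap_vertex σ 1)

lemma simplexPath_apply (σ : Sing0 X x _⦋1⦌) (t : unitInterval) :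
    simplexPath σ t = simplexMap σ (stdSimplexHomeomorphUnitInterval.symm t) := rfl

@[simp] lemma simplexPath_loopSimplex (γ : Path x x) : simplexPath (loopSimplex γ) = γ := by
  ext t
  rw [simplexPath_apply, simplexMap_loopSimplex, Homeomorph.apply_symm_apply]

@[simp] lemma loopSimplex_simplexPath (σ : Sing0 X x _⦋1⦌) : loopSimplex (simplexPath σ) = σ := by
  refine simplexMap_injective (ContinuousMap.ext fun z => ?_)
  rw [simplexMap_loopSimplex, simplexPath_apply, Homeomorph.symm_apply_apply]

/-- The degenerate simplex factors through the one-point simplex, whose image is the base point. -/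
lemma loopSimplex_refl (p : Sing0 X x _⦋0⦌) :
    loopSimplex (Path.refl x) = (Sing0 X x).σ 0 p := by
  refine simplexMap_injective (ContinuousMap.ext fun z => ?_)
  rw [simplexMap_loopSimplex, simplexMap_σ, Path.refl_apply]
  have h : stdSimplex.map (Fin.predAbove (0 : Fin 1)) z = stdSimplex.vertex 0 :=
    @Subsingleton.elim (stdSimplex ℝ (Fin 1)) inferInstance _ _
  exact (simplexMap_vertex p 0).symm.trans (congrArg _ h.symm)

lemma simplexPath_of_mem_degenerate {σ : Sing0 X x _⦋1⦌} (h : σ ∈ (Sing0 X x).degenerate 1) :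
    simplexPath σ = Path.refl x := by
  rw [SSet.degenerate_eq_iUnion_range_σ] at h
  simp only [Set.mem_iUnion, Set.mem_range] at h
  obtain ⟨j, p, rfl⟩ := h
  obtain rfl : j = 0 := Fin.fin_one_eq_zero j
  rw [← loopSimplex_refl, simplexPath_loopSimplex]

/-- Contractibility gives simple connectedness, so that two edge paths with the same ends are
homotopic in a simplex. -/
instance stdSimplex_contractibleSpace {n : ℕ} : ContractibleSpace (stdSimplex ℝ (Fin (n + 1))) :=
  (convex_stdSimplex ℝ _).contractibleSpace ⟨_, single_mem_stdSimplex ℝ 0⟩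

/-- The straight path between two vertices of a simplex. -/
noncomputable def edgePath {n : ℕ} (e : Fin 2 → Fin n) :
    Path (stdSimplex.vertex (S := ℝ) (e 0)) (stdSimplex.vertex (e 1)) where
  toFun t := stdSimplex.map e (stdSimplexHomeomorphUnitInterval.symm t)
  continuous_toFun := (stdSimplex.continuous_map e).comp (Homeomorph.continuous _)
  source' := by rw [homeomorphUnitInterval_symm_zero, stdSimplex.map_vertex]
  target' := by rw [homeomorphUnitInterval_symm_one, stdSimplex.map_vertex]

lemma loopClass_eq_of_homotopic {γ δ : Path x x} (h : γ.Homotopic δ) : loopClass γ = loopClass δ :=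
  congrArg (fun q => MulOpposite.op (FundamentalGroup.fromPath q)) (Quotient.sound h)

/-- The relation in the fundamental group given by a `2`-simplex. -/
lemma loopClass_simplexPath_δ (τ : Sing0 X x _⦋2⦌) :
    loopClass (simplexPath ((Sing0 X x).δ 1 τ)) =
      loopClass (simplexPath ((Sing0 X x).δ 2 τ)) * loopClass (simplexPath ((Sing0 X x).δ 0 τ)) := by
  rw [← loopClass_trans]
  have v := simplexMap_vertex τ
  -- In the 2-simplex the edge `02` is homotopic to the edge `01` followed by `12`; `τ` pushes this
  -- homotopy to `X`. The middle vertex occurs both as `succAbove 2 1` and as `succAbove 0 0`, which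
  -- agree by evaluation.
  have H := (SimplyConnectedSpace.paths_homotopic (edgePath (Fin.succAbove (1 : Fin 3)))
    ((edgePath (Fin.succAbove (2 : Fin 3))).trans (edgePath (Fin.succAbove (0 : Fin 3))))).map
    (simplexMap τ)
  -- The image of an edge runs between images of vertices, which equal `x` only by a proof; hence
  -- the casts.
  have e : ∀ i : Fin 3, simplexPath ((Sing0 X x).δ i τ) =
      ((edgePath i.succAbove).map (simplexMap τ).continuous).cast (v _).symm (v _).symm := fun i => by
    ext t
    exact simplexMap_δ τ i _
  rw [e, e, e]
  refine loopClass_eq_of_homotopic ?_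
  have H' : Path.Homotopic _ _ := H.pathCast (v 0).symm (v 2).symm
  erw [Path.map_trans] at H'
  exact H'

/-- With `f x` as the base point of `Y`, the image of a loop is a loop without any cast. -/
lemma sing0Map_loopSimplex (f : C(X, Y)) (γ : Path x x) :
    (sing0Map f (rfl : f x = f x)).app _ (loopSimplex γ) = loopSimplex (γ.map f.continuous) := by
  refine simplexMap_injective (ContinuousMap.ext fun z => ?_)
  rw [simplexMap_loopSimplex]
  exact congrArg f (simplexMap_loopSimplex γ z)

lemma piOneMap_loopClass (f : C(X, Y)) (γ : Path x x) :
    piOneMap f (rfl : f x = f x) (loopClass γ) = loopClass (γ.map f.continuous) := by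
  refine congrArg MulOpposite.op ((FundamentalGroup.mapOfEq_apply f rfl _).trans ?_)
  rfl

/-! ### Affine coordinates on the edges of the 2-simplex -/

open unitInterval

lemma homeomorphUnitInterval_symm_apply_zero (t : I) :
    stdSimplexHomeomorphUnitInterval.symm t (0 : Fin 2) = 1 - (t : ℝ) := by
  obtain ⟨z, rfl⟩ := stdSimplexHomeomorphUnitInterval.surjective t
  rw [Homeomorph.symm_apply_apply, ← stdSimplex.add_eq_one z]
  exact (add_sub_cancel_right _ _).symm

lemma homeomorphUnitInterval_symm_apply_one (t : I) :
    stdSimplexHomeomorphUnitInterval.symm t (1 : Fin 2) = (t : ℝ) := by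
  obtain ⟨z, rfl⟩ := stdSimplexHomeomorphUnitInterval.surjective t
  rw [Homeomorph.symm_apply_apply]
  rfl

/-- The point of the `2`-simplex at parameter `t` of the `i`-th edge. -/
noncomputable def edgePoint (i : Fin 3) (t : I) : stdSimplex ℝ (Fin 3) :=
  stdSimplex.map i.succAbove (stdSimplexHomeomorphUnitInterval.symm t)

/-- In barycentric coordinates the edges opposite to the vertices 0, 1, 2 are `(0, 1 - t, t)`, `(1 -
t, 0, t)` and `(1 - t, t, 0)`. -/
lemma edgePoint_apply (i j : Fin 3) (t : I) : edgePoint i t j =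
    (if i.succAbove 0 = j then 1 - (t : ℝ) else 0) + if i.succAbove 1 = j then (t : ℝ) else 0 := by
  rw [edgePoint, stdSimplex.map_coe, FunOnFinite.linearMap_apply_apply, Finset.sum_filter,
    Fin.sum_univ_two, homeomorphUnitInterval_symm_apply_zero, homeomorphUnitInterval_symm_apply_one]

/-- The parameter `z₁ + z₂` on the `2`-simplex. -/
noncomputable def param₁ : C(stdSimplex ℝ (Fin 3), I) where
  toFun z := ⟨z 1 + z 2, add_nonneg (stdSimplex.zero_le z 1) (stdSimplex.zero_le z 2), by
    have h := stdSimplex.sum_eq_one z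
    rw [Fin.sum_univ_three] at h
    linarith [stdSimplex.zero_le z 0]⟩
  continuous_toFun := Continuous.subtype_mk
    (((continuous_apply 1).comp continuous_subtype_val).add
      ((continuous_apply 2).comp continuous_subtype_val)) _

/-- The parameter `z₂` on the `2`-simplex. -/
noncomputable def param₂ : C(stdSimplex ℝ (Fin 3), I) where
  toFun z := ⟨z 2, stdSimplex.zero_le z 2, stdSimplex.le_one z 2⟩
  continuous_toFun := Continuous.subtype_mk ((continuous_apply 2).comp continuous_subtype_val) _

/-- The parameter `z₁ / 2 + z₂` on the `2`-simplex. -/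
noncomputable def paramMid : C(stdSimplex ℝ (Fin 3), I) where
  toFun z := ⟨z 1 / 2 + z 2, by linarith [stdSimplex.zero_le z 1, stdSimplex.zero_le z 2], by
    have h := stdSimplex.sum_eq_one z
    rw [Fin.sum_univ_three] at h
    linarith [stdSimplex.zero_le z 0, stdSimplex.zero_le z 1]⟩
  continuous_toFun := Continuous.subtype_mk
    ((((continuous_apply 1).comp continuous_subtype_val).div_const 2).add
      ((continuous_apply 2).comp continuous_subtype_val)) _

/-- Together `param₂` and `param₁` map the simplex onto one of the halves of the unit square, with
edge 1 as the diagonal; exchanging them gives the other half. -/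
lemma param₁_edgePoint (t : I) :
    param₁ (edgePoint 0 t) = 1 ∧ param₁ (edgePoint 1 t) = t ∧ param₁ (edgePoint 2 t) = t := by
  refine ⟨Subtype.ext ?_, Subtype.ext ?_, Subtype.ext ?_⟩ <;>
    simp [param₁, edgePoint_apply, Fin.succAbove, Fin.ext_iff, Fin.lt_def]

lemma param₂_edgePoint (t : I) :
    param₂ (edgePoint 0 t) = t ∧ param₂ (edgePoint 1 t) = t ∧ param₂ (edgePoint 2 t) = 0 := by
  refine ⟨Subtype.ext ?_, Subtype.ext ?_, Subtype.ext ?_⟩ <;>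
    simp [param₂, edgePoint_apply, Fin.succAbove, Fin.ext_iff, Fin.lt_def]

/-- `paramMid` sends the vertices to `0`, `1/2`, `1`. Edges 2 and 0 cover the two halves of the
interval at the speed that `Path.trans` uses. -/
lemma paramMid_edgePoint (t : I) :
    (paramMid (edgePoint 0 t) : ℝ) = (1 + t) / 2 ∧ paramMid (edgePoint 1 t) = t ∧
      (paramMid (edgePoint 2 t) : ℝ) = t / 2 := by
  refine ⟨?_, Subtype.ext ?_, ?_⟩ <;>
    simp [paramMid, edgePoint_apply, Fin.succAbove, Fin.ext_iff, Fin.lt_def]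
  ring

end SingularLoops

/-! ### Homotopy and concatenation of loops in `H₀` -/

namespace CobarH0

open Simplicial

variable (k : Type v) [CommRing k] {X Y : Type u} [TopologicalSpace X] [TopologicalSpace Y] {x : X}

/-- The relation in `H₀` between the edges of a triangle. -/
lemma one_add_bar_of_triangle (g : C(stdSimplex ℝ (Fin 3), X)) {p q r : Path x x}
    (hp : ∀ t, g (edgePoint 2 t) = p t) (hq : ∀ t, g (edgePoint 0 t) = q t)
    (hr : ∀ t, g (edgePoint 1 t) = r t) :
    1 + bar k (loopSimplex r) = (1 + bar k (loopSimplex p)) * (1 + bar k (loopSimplex q)) := by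
  -- Vertices 0 and 1 are the ends of edge 2, and vertex 2 is the end of edge 0; as `p` and `q` are
  -- loops, all three lie over `x`.
  have hv : ∀ i, g (stdSimplex.vertex i) = x := by
    have h0 := hp 0
    have h1 := hp 1
    have h2 := hq 1
    simp only [edgePoint, homeomorphUnitInterval_symm_zero, homeomorphUnitInterval_symm_one,
      stdSimplex.map_vertex, Path.source, Path.target] at h0 h1 h2
    intro i
    fin_cases i
    · exact h0
    · exact h1
    · exact h2
  have e : ∀ (i : Fin 3) (s : Path x x), (∀ t, g (edgePoint i t) = s t) →
      (Sing0 X x).δ i (mkSimplex g hv) = loopSimplex s := fun i s hs => by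
    rw [← loopSimplex_simplexPath ((Sing0 X x).δ i (mkSimplex g hv))]
    congr 1
    ext t
    rw [simplexPath_apply, simplexMap_δ, simplexMap_mkSimplex]
    exact hs t
  rw [← e 2 p hp, ← e 0 q hq, ← e 1 r hr]
  exact one_add_bar (mkSimplex g hv)

lemma bar_refl : bar k (loopSimplex (Path.refl x)) = 0 :=
  bar_degenerate k (by
    rw [loopSimplex_refl default]
    exact SSet.σ_mem_degenerate _ _ _)

/-- The triangle is `p.trans q` composed with the collapse `paramMid` of the simplex onto the
interval: its short edges are `p` and `q`, its long edge the whole concatenation. -/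
lemma one_add_bar_trans (p q : Path x x) : 1 + bar k (loopSimplex (p.trans q)) =
    (1 + bar k (loopSimplex p)) * (1 + bar k (loopSimplex q)) := by
  refine one_add_bar_of_triangle k ((p.trans q).toContinuousMap.comp paramMid)
    (fun t => ?_) (fun t => ?_) (fun t => ?_)
  · have h := (paramMid_edgePoint t).2.2
    change p.trans q (paramMid (edgePoint 2 t)) = p t
    rw [Path.trans_apply, dif_pos (by rw [h]; linarith [t.2.2])]
    congr 1
    ext
    simp [h, mul_div_cancel₀]
  · have h := (paramMid_edgePoint t).1
    change p.trans q (paramMid (edgePoint 0 t)) = q t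
    rw [Path.trans_apply]
    -- The first branch of `Path.trans` occurs here only at the midpoint, that is at `t = 0`, where
    -- the end of `p` and the start of `q` are both `x`.
    split_ifs with h'
    · rw [h] at h'
      obtain rfl : t = 0 := Subtype.ext (le_antisymm (by
        change (t : ℝ) ≤ 0
        linarith) t.2.1)
      rw [Path.source]
      convert p.target
      simp [h]
    · congr 1
      ext
      simp [h, mul_div_cancel₀]
  · exact congrArg (p.trans q) (paramMid_edgePoint t).2.1

/-- The diagonal `r` of the homotopy square cuts it into two triangles. The sides of the square at
times `0` and `1` are constant, so the triangles give `1 + [r] = 1 + [p]` and `1 + [r] = 1 + [q]`.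
-/
lemma bar_eq_of_homotopic {p q : Path x x} (h : p.Homotopic q) :
    bar k (loopSimplex p) = bar k (loopSimplex q) := by
  obtain ⟨F⟩ := h
  let r : Path x x :=
    { toFun := fun t => F (t, t)
      continuous_toFun := by fun_prop
      source' := by simp
      target' := by simp }
  -- This triangle runs along `p` and then along the constant side at time `1`.
  have h1 := one_add_bar_of_triangle k (p := p) (q := Path.refl x) (r := r)
    (F.toContinuousMap.comp (param₂.prodMk param₁))
    (fun t => by
      change F (param₂ (edgePoint 2 t), param₁ (edgePoint 2 t)) = p t
      rw [(param₁_edgePoint t).2.2, (param₂_edgePoint t).2.2]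
      simp)
    (fun t => by
      change F (param₂ (edgePoint 0 t), param₁ (edgePoint 0 t)) = x
      rw [(param₁_edgePoint t).1, (param₂_edgePoint t).1]
      simp)
    (fun t => by
      change F (param₂ (edgePoint 1 t), param₁ (edgePoint 1 t)) = F (t, t)
      rw [(param₁_edgePoint t).2.1, (param₂_edgePoint t).2.1])
  -- This one runs along the constant side at time `0` and then along `q`.
  have h2 := one_add_bar_of_triangle k (p := Path.refl x) (q := q) (r := r)
    (F.toContinuousMap.comp (param₁.prodMk param₂))
    (fun t => by
      change F (param₁ (edgePoint 2 t), param₂ (edgePoint 2 t)) = x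
      rw [(param₁_edgePoint t).2.2, (param₂_edgePoint t).2.2]
      simp)
    (fun t => by
      change F (param₁ (edgePoint 0 t), param₂ (edgePoint 0 t)) = q t
      rw [(param₁_edgePoint t).1, (param₂_edgePoint t).1]
      simp)
    (fun t => by
      change F (param₁ (edgePoint 1 t), param₂ (edgePoint 1 t)) = F (t, t)
      rw [(param₁_edgePoint t).2.1, (param₂_edgePoint t).2.1])
  rw [bar_refl, add_zero, mul_one] at h1
  rw [bar_refl, add_zero, one_mul] at h2
  exact add_left_cancel (h1.symm.trans h2)

/-! ### The isomorphism with the group algebra of the fundamental group -/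

/-- The multiplicative map `π₁(X, x) → H₀`, `g_σ ↦ 1 + [σ]`. -/
noncomputable def ofPiOne (X : Type u) [TopologicalSpace X] (x : X) : PiOne X x →* SingH0 k X x where
  toFun g := Quotient.lift (fun γ : Path x x => 1 + bar k (loopSimplex γ))
    (fun _ _ h => congrArg (1 + ·) (bar_eq_of_homotopic k h)) (FundamentalGroup.toPath g.unop)
  map_one' := by
    change 1 + bar k (loopSimplex (Path.refl x)) = 1
    rw [bar_refl, add_zero]
  map_mul' := by
    rintro ⟨g⟩ ⟨h⟩
    induction g using Quotient.inductionOn with | _ p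
    induction h using Quotient.inductionOn with | _ q
    exact one_add_bar_trans k p q

lemma ofPiOne_loopClass (γ : Path x x) :
    ofPiOne k X x (loopClass γ) = 1 + bar k (loopSimplex γ) := rfl

lemma exists_loopClass_eq (g : PiOne X x) : ∃ γ : Path x x, loopClass γ = g := by
  obtain ⟨g⟩ := g
  induction g using Quotient.inductionOn with | _ p
  exact ⟨p, rfl⟩

/-- The algebra map `H₀ → k[π₁(X, x)]`, `[σ] ↦ g_σ - 1`. -/
noncomputable def toGroupAlgebra (X : Type u) [TopologicalSpace X] (x : X) :
    SingH0 k X x →ₐ[k] MonoidAlgebra k (PiOne X x) :=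
  lift (fun σ => MonoidAlgebra.of k (PiOne X x) (loopClass (simplexPath σ)) - 1)
    (fun σ h => by
      rw [simplexPath_of_mem_degenerate h, sub_eq_zero]
      exact map_one _)
    (fun τ => by
      -- Since `1 + (g - 1) = g`, the relation required by `lift` is the triangle relation in the
      -- fundamental group.
      rw [add_sub_cancel, add_sub_cancel, add_sub_cancel, loopClass_simplexPath_δ, map_mul])

lemma toGroupAlgebra_bar (γ : Path x x) : toGroupAlgebra k X x (bar k (loopSimplex γ)) =
    MonoidAlgebra.of k (PiOne X x) (loopClass γ) - 1 := by
  rw [toGroupAlgebra, lift_bar, simplexPath_loopSimplex]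

/-- The isomorphism of algebras between `H₀` and the group algebra of the fundamental group. -/
noncomputable def algEquivGroupAlgebra (X : Type u) [TopologicalSpace X] (x : X) :
    SingH0 k X x ≃ₐ[k] MonoidAlgebra k (PiOne X x) :=
  AlgEquiv.ofAlgHom (toGroupAlgebra k X x) (MonoidAlgebra.lift k _ _ (ofPiOne k X x))
    (MonoidAlgebra.algHom_ext (fun g => by
      obtain ⟨γ, rfl⟩ := exists_loopClass_eq g
      rw [AlgHom.comp_apply, MonoidAlgebra.lift_single, one_smul, ofPiOne_loopClass, map_add,
        map_one, toGroupAlgebra_bar, add_sub_cancel]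
      rfl) (Subsingleton.elim _ _))
    (algHom_ext fun σ => by
      rw [← loopSimplex_simplexPath σ, AlgHom.comp_apply, toGroupAlgebra_bar, map_sub, map_one,
        MonoidAlgebra.lift_of, ofPiOne_loopClass, add_sub_cancel_left]
      rfl)

/-- The isomorphism of bialgebras between `H₀` and the group algebra of the fundamental group. -/
noncomputable def equivGroupAlgebra (X : Type u) [TopologicalSpace X] (x : X) :
    SingH0 k X x ≃ₐc[k] MonoidAlgebra k (PiOne X x) :=
  BialgEquiv.ofAlgEquiv (algEquivGroupAlgebra k X x)
    (algHom_ext fun σ => by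
      rw [← loopSimplex_simplexPath σ]
      refine Eq.trans (congrArg (Bialgebra.counitAlgHom k _) (toGroupAlgebra_bar k _)) ?_
      refine Eq.trans ?_ (counit_bar k _ _).symm
      simp)
    (algHom_ext fun σ => by
      rw [← loopSimplex_simplexPath σ]
      refine Eq.trans ?_
        (congrArg (Bialgebra.comulAlgHom k _) (toGroupAlgebra_bar k (simplexPath σ))).symm
      refine (congrArg (Algebra.TensorProduct.map (toGroupAlgebra k X x) (toGroupAlgebra k X x))
        (comul_bar k _ _)).trans ?_
      -- For `u = g - 1` with `g` group-like, both `u ⊗ u + u ⊗ 1 + 1 ⊗ u` and the coproduct of `u`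
      -- are `g ⊗ g - 1 ⊗ 1`.
      simp only [map_add, Algebra.TensorProduct.map_tmul, toGroupAlgebra_bar, map_one, map_sub,
        Bialgebra.comulAlgHom_apply, (MonoidAlgebra.isGroupLikeElem_of _).comul_eq_tmul_self,
        TensorProduct.sub_tmul, TensorProduct.tmul_sub, Algebra.TensorProduct.one_def]
      abel)

lemma equivGroupAlgebra_bar (γ : Path x x) : equivGroupAlgebra k X x (bar k (loopSimplex γ)) =
    MonoidAlgebra.of k (PiOne X x) (loopClass γ) - 1 := toGroupAlgebra_bar k γ

/-- Algebra maps out of `H₀` are determined by the classes of loops, and both sides send `[γ]` to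
the class of `f ∘ γ` minus `1`. -/
lemma equivGroupAlgebra_singH0Map (f : C(X, Y)) {y : Y} (hf : f x = y) (a : SingH0 k X x) :
    equivGroupAlgebra k Y y (singH0Map k f hf a) =
      MonoidAlgebra.mapDomainBialgHom k (piOneMap f hf) (equivGroupAlgebra k X x a) := by
  subst hf
  suffices H : (toGroupAlgebra k Y (f x)).comp (AlgHomClass.toAlgHom (singH0Map k f rfl)) =
      (MonoidAlgebra.mapDomainAlgHom k k (piOneMap f (rfl : f x = f x))).comp
        (toGroupAlgebra k X x) from AlgHom.congr_fun H a
  refine algHom_ext fun σ => ?_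
  rw [← loopSimplex_simplexPath σ]
  refine Eq.trans (congrArg (equivGroupAlgebra k Y (f x)) ((map_bar k _ _).trans
    (congrArg (bar k) (sing0Map_loopSimplex f _)))) ?_
  refine Eq.trans ?_ (congrArg (MonoidAlgebra.mapDomainBialgHom k (piOneMap f rfl))
    (equivGroupAlgebra_bar k _)).symm
  rw [equivGroupAlgebra_bar, map_sub, map_one, ← piOneMap_loopClass, MonoidAlgebra.of_apply,
    MonoidAlgebra.of_apply, MonoidAlgebra.mapDomainBialgHom_single]

/-- The map from the fundamental group to the group-like elements of `H₀`. -/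
noncomputable def groupLikeOfPiOne (X : Type u) [TopologicalSpace X] (x : X) :
    PiOne X x →* GroupLike k (SingH0 k X x) where
  toFun g := ⟨(equivGroupAlgebra k X x).symm (MonoidAlgebra.of k _ g),
    (MonoidAlgebra.isGroupLikeElem_of g).map _⟩
  map_one' := GroupLike.val_injective
    ((congrArg (equivGroupAlgebra k X x).symm (map_one _)).trans (map_one _))
  map_mul' a b := GroupLike.val_injective
    ((congrArg (equivGroupAlgebra k X x).symm (map_mul _ a b)).trans (map_mul _ _ _))

lemma equivGroupAlgebra_groupLikeOfPiOne (g : PiOne X x) :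
    equivGroupAlgebra k X x (groupLikeOfPiOne k X x g).val = MonoidAlgebra.of k _ g :=
  (equivGroupAlgebra k X x).apply_symm_apply _

lemma groupLikeOfPiOne_injective [Nontrivial k] :
    Function.Injective (groupLikeOfPiOne k X x) := fun a b h =>
  MonoidAlgebra.of_injective (R := k) (by
    rw [← equivGroupAlgebra_groupLikeOfPiOne k a, h, equivGroupAlgebra_groupLikeOfPiOne])

/-- For surjectivity, the isomorphism with the group algebra carries a group-like element to a
group-like element, which is a basis element as `k` has only trivial idempotents. -/
lemma groupLikeOfPiOne_bijective [Nontrivial k]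
    (hk : ∀ e : k, IsIdempotentElem e → e = 0 ∨ e = 1) :
    Function.Bijective (groupLikeOfPiOne k X x) := by
  refine ⟨groupLikeOfPiOne_injective k, fun a => ?_⟩
  obtain ⟨g, hg⟩ := MonoidAlgebra.exists_single_eq_of_isGroupLikeElem hk
    (a.isGroupLikeElem_val.map (equivGroupAlgebra k X x))
  refine ⟨g, GroupLike.val_injective ((equivGroupAlgebra k X x).injective ?_)⟩
  exact (equivGroupAlgebra_groupLikeOfPiOne k g).trans hg

end CobarH0

/-! ### The main theorem -/

theorem mainTheorem2 {k : Type v} [CommRing k] [Nontrivial k] {X Y : Type u} [TopologicalSpace X]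
    [TopologicalSpace Y] [PathConnectedSpace X] [PathConnectedSpace Y] (x : X) (y : Y) (f : C(X, Y))
    (hf : f x = y) (h : (singChainsMap k f hf).IsOmegaQuasiIso) :
    -- `π₁(f)` is an isomorphism of groups
    (∃ e : FundamentalGroup X x ≃* FundamentalGroup Y y,
      ∀ g, e g = FundamentalGroup.mapOfEq f hf g) ∧
    -- `H₀(Ω C⁰_*(f))` is an isomorphism of Hopf algebras
    (HasAntipode k (SingH0 k X x) ∧ HasAntipode k (SingH0 k Y y) ∧
      ∃ E : SingH0 k X x ≃ₐc[k] SingH0 k Y y, ∀ a, E a = singH0Map k f hf a) ∧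
    -- which is identified with `k[π₁(f)]` by means of `[γ] ↦ γ - 1`
    ∃ (ψX : SingH0 k X x ≃ₐc[k] MonoidAlgebra k (PiOne X x))
      (ψY : SingH0 k Y y ≃ₐc[k] MonoidAlgebra k (PiOne Y y)),
      (∀ γ : Path x x,
        ψX (CobarH0.bar k (loopSimplex γ)) = MonoidAlgebra.of k (PiOne X x) (loopClass γ) - 1) ∧
      (∀ γ : Path y y,
        ψY (CobarH0.bar k (loopSimplex γ)) = MonoidAlgebra.of k (PiOne Y y) (loopClass γ) - 1) ∧
      (∀ a, ψY (singH0Map k f hf a) =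
        MonoidAlgebra.mapDomainBialgHom k (piOneMap f hf) (ψX a)) ∧
      -- and group-like elements recover `π₁(f)`
      ∃ (κX : PiOne X x →* GroupLike k (SingH0 k X x))
        (κY : PiOne Y y →* GroupLike k (SingH0 k Y y)),
        (∀ g, ψX (κX g).val = MonoidAlgebra.of k (PiOne X x) g) ∧
        (∀ g, ψY (κY g).val = MonoidAlgebra.of k (PiOne Y y) g) ∧
        Function.Injective κX ∧ Function.Injective κY ∧
        ((∀ e : k, IsIdempotentElem e → e = 0 ∨ e = 1) →
          Function.Bijective κX ∧ Function.Bijective κY) ∧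
        (∀ g, groupLikeMap (singH0Map k f hf) (κX g) = κY (piOneMap f hf g)) ∧
        Function.Bijective (groupLikeMap (singH0Map k f hf)) := by
  -- Degree zero is all that is needed of the quasi-isomorphism.
  have hH0 : Function.Bijective (singH0Map k f hf) := DGAlg.Hom.H0Map_bijective h
  have hsq := CobarH0.equivGroupAlgebra_singH0Map k f hf
  -- By naturality, `k[π₁(f)]` is the map on `H₀` conjugated by the two isomorphisms.
  have hmap : Function.Bijective (MonoidAlgebra.mapDomainBialgHom k (piOneMap f hf)) := by
    have e : (MonoidAlgebra.mapDomainBialgHom k (piOneMap f hf) : _ → _) =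
        CobarH0.equivGroupAlgebra k Y y ∘ singH0Map k f hf ∘
          (CobarH0.equivGroupAlgebra k X x).symm := by
      ext1 a
      rw [Function.comp_apply, Function.comp_apply, hsq, BialgEquiv.apply_symm_apply]
    rw [e]
    exact (CobarH0.equivGroupAlgebra k Y y).bijective.comp
      (hH0.comp (CobarH0.equivGroupAlgebra k X x).symm.bijective)
  -- The group algebras are those of the opposite groups; as a map of sets `piOneMap` is the same
  -- map, conjugated by `op`.
  have hpi : Function.Bijective (FundamentalGroup.mapOfEq f hf) := by
    have hop := MonoidAlgebra.bijective_of_mapDomainBialgHom_bijective _ hmap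
    exact MulOpposite.unop_bijective.comp (hop.comp MulOpposite.op_bijective)
  refine ⟨⟨MulEquiv.ofBijective _ hpi, fun _ => rfl⟩,
    ⟨hasAntipode_of_bialgEquiv (CobarH0.equivGroupAlgebra k X x),
      hasAntipode_of_bialgEquiv (CobarH0.equivGroupAlgebra k Y y),
      BialgEquiv.ofBijective _ hH0, fun _ => rfl⟩,
    CobarH0.equivGroupAlgebra k X x, CobarH0.equivGroupAlgebra k Y y,
    CobarH0.equivGroupAlgebra_bar k, CobarH0.equivGroupAlgebra_bar k, hsq,
    CobarH0.groupLikeOfPiOne k X x, CobarH0.groupLikeOfPiOne k Y y,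
    CobarH0.equivGroupAlgebra_groupLikeOfPiOne k, CobarH0.equivGroupAlgebra_groupLikeOfPiOne k,
    CobarH0.groupLikeOfPiOne_injective k, CobarH0.groupLikeOfPiOne_injective k,
    fun hk => ⟨CobarH0.groupLikeOfPiOne_bijective k hk, CobarH0.groupLikeOfPiOne_bijective k hk⟩,
    fun g => GroupLike.val_injective ((CobarH0.equivGroupAlgebra k Y y).injective ?_),
    groupLikeMap_bijective hH0⟩
  -- The compatibility of the `κ` maps is checked in `k[π₁(Y)]`, where naturality turns both sides
  -- into the basis element of the image of `g`.
  refine (hsq _).trans ?_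
  refine Eq.trans ?_ (CobarH0.equivGroupAlgebra_groupLikeOfPiOne k _).symm
  rw [CobarH0.equivGroupAlgebra_groupLikeOfPiOne, MonoidAlgebra.of_apply, MonoidAlgebra.of_apply,
    MonoidAlgebra.mapDomainBialgHom_single]
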